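/- **Setting.** There are $K\ge 1$ clients with differentiable local objectives $\mathcal L_k:\mathbb R^D\to\mathbb R$; the global objective is $\mathcal L=\frac1K\sum_{k=1}^K\mathcal L_k$. The local solver is a vector $\boldsymbol a=(a_1,\dots,a_I)\neq 0$ with entries $a_i\ge 0$, and $\|\boldsymbol a\|_1=\sum_i|a_i|$. All clients start from a given $\boldsymbol\Theta^0\in\mathbb R^D$. In each training round, client $k$ updates its current local model by $I$ iterations $x\leftarrow x-\eta a_i\nabla\mathcal L_k(x\,|\,\xi)$, $i=1,\dots,I$, where $\nabla\mathcal L_k(x\,|\,\xi)$ is a stochastic gradient on a fresh mini-batch $\xi$, drawn from a law of client $k$; mini-batches used in different rounds or iterations are independent. At the end of the round the server either recovers the exact global model, that is, it adds the average over the clients of the local updates accumulated since the last recovered global model to that global model, and all clients restart from the result; or recovery fails, and all clients continue from their own local models. The recovery outcomes of the rounds are i.i.d., with failure probability $P_O$, and independent of the mini-batches. Let $\boldsymbol\Theta^t$ be the global model after the $t$-th successful recovery and $R_t$ the number of rounds from the $(t-1)$-st (excluded) to the $t$-th (included) successful recovery. For $T\ge 1$ let $T_c=\min\{n:\sum_{t=1}^nR_t\ge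 T\}$ be the number of successful global updates. **Assumptions.** For some $G>0$, $\mathcal L^\star$, $\sigma^2>0$, $\beta^2\ge1$, $\kappa^2\ge0$, for all $k$ and all $x,y\in\mathbb R^D$: 1. (smoothness) $\mathcal L_k(x)\ge\mathcal L^\star$ and $\|\nabla\mathcal L_k(x)-\nabla\mathcal L_k(y)\|\le G\|x-y\|$; 2. (unbiasedness and bounded variance) $\mathbb E_\xi[\nabla\mathcal L_k(x|\xi)]=\nabla\mathcal L_k(x)$ and $\mathbb E_\xi\|\nabla\mathcal L_k(x|\xi)-\nabla\mathcal L_k(x)\|^2\le\sigma^2$; 3. (bounded dissimilarity) $\frac1K\sum_{k=1}^K\|\nabla\mathcal L_k(x)\|^2\le\beta^2\|\nabla\mathcal L(x)\|^2+\kappa^2$. **Theorem.** Let $0<P_O<\frac13$. There is a $T_0$, depending only on $K$, $\boldsymbol a$, $P_O$ and $\beta$, such that for every $T\ge T_0$ and learning rate $\eta=\frac1G\sqrt{\frac KT}$ the following holds with probability larger than $99.73\%$ over the recovery outcomes, where $\mathbb E$ is the expectation over the mini-batches for given recovery outcomes: the expectations below are finite and $$\frac1{T_c}\sum_{t=1}^{T_c}\mathbb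 E\|\nabla\mathcal L(\boldsymbol\Theta^{t-1})\|^2\le\frac1{T_c}\sum_{t=1}^{T_c}R_t\,\mathbb E\|\nabla\mathcal L(\boldsymbol\Theta^{t-1})\|^2\le\frac{2G(\mathcal L(\boldsymbol\Theta^0)-\mathcal L^\star)}{\|\boldsymbol a\|_1(1-P_O)(1-3P_O)\sqrt{KT}}+2\sqrt{\frac KT}\,\|\boldsymbol a\|_1\,\frac{1-P_O}{P_O}\,\psi(P_O)\,(\sigma^2+2\kappa^2).$$ Here $\psi(P_O)=\mathrm{Li}_{-2}(P_O)+\frac3{T_{s2}+1}\big(\mathrm{Li}_{-4}(P_O)-\mathrm{Li}_{-2}(P_O)\big)$, $T_{s2}=T(1-P_O)(1-3P_O)$, and $\mathrm{Li}_{-v}(z)=\sum_{k=1}^\infty k^vz^k$. Moreover, for every integer $v\ge0$ and real $|z|<1$ this series converges, and $\mathrm{Li}_{-v}(z)=\left(z\frac{d}{dz}\right)^v\frac z{1-z}$. -/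

import Mathlib

open MeasureTheory ProbabilityTheory

noncomputable section

/-! ### Objectives and assumptions

There are `K` clients, models are vectors of `EuclideanSpace ℝ (Fin D)`, `L k` is the local objective
of client `k`, and `g k x z` is the stochastic gradient of client `k` at the model `x` computed on the
mini-batch `z`. -/

/-- The global objective, with equal learning weights `1 / K`. -/
def globalLoss {K D : ℕ} (L : Fin K → EuclideanSpace ℝ (Fin D) → ℝ)
    (x : EuclideanSpace ℝ (Fin D)) : ℝ :=
  (1 / (K : ℝ)) * ∑ k, L k x

/-- Smoothness: the local objectives are bounded below by `Lstar` and have `G`-Lipschitz gradients. -/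
structure Smoothness {K D : ℕ} (L : Fin K → EuclideanSpace ℝ (Fin D) → ℝ)
    (G Lstar : ℝ) : Prop where
  lower_bound : ∀ k x, Lstar ≤ L k x
  differentiable : ∀ k, Differentiable ℝ (L k)
  lipschitz : ∀ k x y, ‖gradient (L k) x - gradient (L k) y‖ ≤ G * ‖x - y‖

/-- Unbiasedness and bounded variance of the stochastic gradients, when the mini-batches of client
`k` have law `ν k`. -/
structure UnbiasedBoundedVariance {K D : ℕ} {Ξ : Type*} [MeasurableSpace Ξ]
    (L : Fin K → EuclideanSpace ℝ (Fin D) → ℝ)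
    (g : Fin K → EuclideanSpace ℝ (Fin D) → Ξ → EuclideanSpace ℝ (Fin D))
    (ν : Fin K → Measure Ξ) (σ : ℝ) : Prop where
  measurable : ∀ k, Measurable (fun p : EuclideanSpace ℝ (Fin D) × Ξ => g k p.1 p.2)
  integrable : ∀ k x, Integrable (fun z => g k x z) (ν k)
  unbiased : ∀ k x, ∫ z, g k x z ∂(ν k) = gradient (L k) x
  integrable_sq : ∀ k x, Integrable (fun z => ‖g k x z - gradient (L k) x‖ ^ 2) (ν k)
  variance_le : ∀ k x, ∫ z, ‖g k x z - gradient (L k) x‖ ^ 2 ∂(ν k) ≤ σ ^ 2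

/-- Bounded dissimilarity between the local objectives and the global one. -/
def BoundedDissimilarity {K D : ℕ} (L : Fin K → EuclideanSpace ℝ (Fin D) → ℝ)
    (β κ : ℝ) : Prop :=
  ∀ x, (1 / (K : ℝ)) * ∑ k, ‖gradient (L k) x‖ ^ 2 ≤
    β ^ 2 * ‖gradient (globalLoss L) x‖ ^ 2 + κ ^ 2

/-! ### Randomness -/

/-- The mini-batches: `ξ r i k` is the one used by client `k` in iteration `i` of round `r`. It has
law `ν k`, and the mini-batches used at distinct pairs (round, iteration) are independent. -/
structure IsMiniBatchSampling {K I : ℕ} {Ξ Ω : Type*} [MeasurableSpace Ξ] [MeasurableSpace Ω]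
    (Q : Measure Ω) (ν : Fin K → Measure Ξ) (ξ : ℕ → Fin I → Fin K → Ω → Ξ) : Prop where
  measurable : ∀ r i k, Measurable (ξ r i k)
  law : ∀ r i k, Q.map (ξ r i k) = ν k
  indep : iIndepFun (fun (p : ℕ × Fin I) (ω : Ω) (k : Fin K) => ξ p.1 p.2 k ω) Q

/-- Binary recovery with failure probability `PO`: `S r` tells whether the server recovers the global
model at the end of round `r`, and these outcomes are i.i.d. Bernoulli of parameter `1 - PO`. -/
structure IsBinaryRecovery {Ω : Type*} [MeasurableSpace Ω]
    (P : Measure Ω) (S : ℕ → Ω → Bool) (PO : ℝ) : Prop where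
  measurable : ∀ r, Measurable (S r)
  indep : iIndepFun S P
  prob_success : ∀ r, P.real {ω | S r ω = true} = 1 - PO

/-! ### Dynamics -/

/-- One training round of local training of one client: `I` iterations
`x ← x - η aᵢ g(x, zᵢ)`, in the order `i = 0, …, I - 1`. -/
def localTraining {D I : ℕ} {Ξ : Type*} (η : ℝ) (a : Fin I → ℝ)
    (g : EuclideanSpace ℝ (Fin D) → Ξ → EuclideanSpace ℝ (Fin D)) (z : Fin I → Ξ)
    (x : EuclideanSpace ℝ (Fin D)) : EuclideanSpace ℝ (Fin D) :=
  Fin.foldl I (fun y i => y - (η * a i) • g y (z i)) x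

/-- The last recovered global model and the current local models. -/
structure SystemState (K D : ℕ) where
  glob : EuclideanSpace ℝ (Fin D)
  loc : Fin K → EuclideanSpace ℝ (Fin D)

/-- The state after `r` rounds, for the recovery outcomes `s` and the mini-batches `z`. In each round
every client trains locally, starting from its current local model. If recovery succeeds, the average
of the local updates accumulated since the last recovered global model is added to that global model
and every client restarts from the result; if it fails, every client keeps its local model. -/
def systemState {K D I : ℕ} {Ξ : Type*} (η : ℝ) (a : Fin I → ℝ)
    (g : Fin K → EuclideanSpace ℝ (Fin D) → Ξ → EuclideanSpace ℝ (Fin D))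
    (Θ₀ : EuclideanSpace ℝ (Fin D)) (s : ℕ → Bool) (z : ℕ → Fin I → Fin K → Ξ) :
    ℕ → SystemState K D
  | 0 => ⟨Θ₀, fun _ => Θ₀⟩
  | r + 1 =>
    let old := systemState η a g Θ₀ s z r
    let trained : Fin K → EuclideanSpace ℝ (Fin D) :=
      fun k => localTraining η a (g k) (fun i => z r i k) (old.loc k)
    let new := old.glob + (1 / (K : ℝ)) • ∑ k, (trained k - old.glob)
    if s r = true then ⟨new, fun _ => new⟩ else ⟨old.glob, trained⟩

/-- The number of rounds executed when the `t`-th successful recovery has just taken place (rounds are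
numbered from `0`, and `Nat.nth` counts from `0`). -/
def successTime (s : ℕ → Bool) : ℕ → ℕ
  | 0 => 0
  | t + 1 => Nat.nth (fun r => s r = true) t + 1

/-- The number of rounds from the `(t-1)`-st successful recovery (excluded) to the `t`-th (included),
for `t ≥ 1`. -/
def roundsBetween (s : ℕ → Bool) (t : ℕ) : ℕ :=
  successTime s t - successTime s (t - 1)

/-- The number of successful global updates `min {n | R 1 + ⋯ + R n ≥ T}`. -/
def numUpdates (s : ℕ → Bool) (T : ℕ) : ℕ :=
  sInf {n : ℕ | T ≤ ∑ t ∈ Finset.Icc 1 n, roundsBetween s t}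

/-- The global model after `t` successful recoveries. -/
def globalModel {K D I : ℕ} {Ξ : Type*} (η : ℝ) (a : Fin I → ℝ)
    (g : Fin K → EuclideanSpace ℝ (Fin D) → Ξ → EuclideanSpace ℝ (Fin D))
    (Θ₀ : EuclideanSpace ℝ (Fin D)) (s : ℕ → Bool) (z : ℕ → Fin I → Fin K → Ξ) (t : ℕ) :
    EuclideanSpace ℝ (Fin D) :=
  (systemState η a g Θ₀ s z (successTime s t)).glob

/-- `‖∇L(Θᵗ)‖²` for the recovery outcomes `s` and the mini-batches `z`, where `L` is the global
objective and `Θᵗ` the global model after `t` successful recoveries. -/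
def sqGradNorm {K D I : ℕ} {Ξ : Type*} (L : Fin K → EuclideanSpace ℝ (Fin D) → ℝ)
    (η : ℝ) (a : Fin I → ℝ)
    (g : Fin K → EuclideanSpace ℝ (Fin D) → Ξ → EuclideanSpace ℝ (Fin D))
    (Θ₀ : EuclideanSpace ℝ (Fin D)) (s : ℕ → Bool) (z : ℕ → Fin I → Fin K → Ξ) (t : ℕ) : ℝ :=
  ‖gradient (globalLoss L) (globalModel η a g Θ₀ s z t)‖ ^ 2

/-! ### The quantities of the bound -/

/-- The `ℓ¹` norm of a vector. -/
def l1Norm {I : ℕ} (a : Fin I → ℝ) : ℝ := ∑ i, |a i|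

/-- The polylogarithm `Li_{-v}(z) = ∑_{k ≥ 1} k ^ v z ^ k`. -/
def polylogNeg (v : ℕ) (z : ℝ) : ℝ := ∑' k : ℕ, ((k : ℝ) + 1) ^ v * z ^ (k + 1)

/-- `T_{s2} = T (1 - PO) (1 - 3 PO)`. -/
def Ts2 (T : ℕ) (PO : ℝ) : ℝ := T * (1 - PO) * (1 - 3 * PO)

/-- `ψ(PO) = Li_{-2}(PO) + 3 / (T_{s2} + 1) * (Li_{-4}(PO) - Li_{-2}(PO))`. -/
def psi (T : ℕ) (PO : ℝ) : ℝ :=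
  polylogNeg 2 PO + 3 / (Ts2 T PO + 1) * (polylogNeg 4 PO - polylogNeg 2 PO)

end

/-!
Between two recoveries the clients run stochastic gradient descent from a common model `Θ`, and the
next recovered model is `Θ - η (N + ∑ wⱼ bⱼ)`, where `N` collects the gradient noise and `bⱼ` is the
average of the local gradients at the current local models. The descent lemma turns this into a
decrease of the global objective of `η W / 2 ‖∇L(Θ)‖²` for a period of total weight `W`, up to two
errors (`le_of_noisy_step`). The first is the variance of `N`: the noise terms are orthogonal
martingale increments, since each mini-batch is independent of the past, so their variances add up
to `σ² ∑ wⱼ²` (`IsFreshSampling.integral_norm_sq_sum_sgdNoise_le`). The second is the drift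
`‖bⱼ - ∇L(Θ)‖²`, which smoothness bounds by the distance of the local models from `Θ`
(`IsFreshSampling.integral_norm_sq_sgdPath_sub_le`); it is of order `η²`, with the squared gradient
controlled through the bounded dissimilarity. Only convexity is used to average over the clients, so
their mini-batches of the same iteration may be dependent.

For given recovery outcomes the one-period estimates telescope
(`sum_rounds_mul_integral_sqGradNorm_le`): if every period has at most `M` rounds and
`G η ‖a‖₁ M² ≤ δ`, the weighted sum of the squared gradients is at most
`2 (L(Θ⁰) - L⋆) / (η ‖a‖₁) + 2 G η ‖a‖₁ (σ² + 2 κ²) ∑ R_t`, up to factors `1 + O(δ)`.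

Compared with this, the claimed bound has room to spare in both terms, by factors that depend on the
failure probability `p` only. The number of updates is about `T (1 - p)`, against
`T (1 - p) (1 - 3 p)` in the bound, and the mean of the `R_t` is about `1 / (1 - p)`, whereas
`(1 - p) / p * ψ(p)` is at least `(1 + p) / (1 - p) ^ 2`, the second moment of a geometric variable
(`le_psi`). So the bound holds as soon as there are at least `T (1 - p) (1 - p / 4)` successes in
the first `T` rounds, which has probability close to one by Chebyshev's inequality, and no run of about
`2 log₂ T` failures starts there, which has probability close to one by a union bound
(`IsBinaryRecovery.prob_typical_ge`, `exists_run_length`, `mean_le_of_sum_le`).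
-/

/-! ### Polylogarithms of nonpositive integer order -/

lemma summable_succ_pow_mul_geometric (v : ℕ) {z : ℝ} (hz : |z| < 1) :
    Summable (fun k : ℕ => ((k : ℝ) + 1) ^ v * z ^ (k + 1)) := by
  have h := summable_pow_mul_geometric_of_norm_lt_one (R := ℝ) v (r := z) (by simpa using hz)
  simpa using (summable_nat_add_iff 1).2 h

lemma hasDerivAt_polylogNeg (v : ℕ) {z : ℝ} (hz : |z| < 1) :
    HasDerivAt (polylogNeg v) (∑' k : ℕ, ((k : ℝ) + 1) ^ (v + 1) * z ^ k) z := by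
  obtain ⟨ρ, hzρ, hρ⟩ := exists_between hz
  have hρ0 : 0 ≤ ρ := (abs_nonneg z).trans hzρ.le
  have hu : Summable (fun k : ℕ => ((k : ℝ) + 1) ^ (v + 1) * ρ ^ k) := by
    have h := summable_succ_pow_mul_geometric (v + 1) (z := ρ) (by rwa [abs_of_nonneg hρ0])
    rcases hρ0.eq_or_lt with h0 | h0
    · exact absurd hzρ (by rw [← h0]; exact not_lt.2 (abs_nonneg z))
    · refine (h.mul_left ρ⁻¹).congr fun k => ?_
      rw [pow_succ ρ]
      field_simp
  refine hasDerivAt_tsum_of_isPreconnected (t := Metric.ball 0 ρ) (y₀ := 0) hu Metric.isOpen_ball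
    (convex_ball _ _).isPreconnected (g := fun (k : ℕ) x => ((k : ℝ) + 1) ^ v * x ^ (k + 1))
    (g' := fun (k : ℕ) x => ((k : ℝ) + 1) ^ (v + 1) * x ^ k) ?_ ?_ ?_ ?_ ?_
  · intro n y _
    have := (hasDerivAt_pow (n + 1) y).const_mul (((n : ℝ) + 1) ^ v)
    refine this.congr_deriv ?_
    push_cast
    rw [pow_succ]
    ring
  · intro n y hy
    rw [norm_mul, norm_pow, norm_pow, Real.norm_eq_abs, Real.norm_eq_abs,
      abs_of_nonneg (by positivity : (0 : ℝ) ≤ (n : ℝ) + 1)]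
    have : |y| ≤ ρ := by simpa using (Metric.mem_ball.1 hy).le
    gcongr
  · simpa using (abs_nonneg z).trans_lt hzρ
  · simp
  · simpa using hzρ

/-- On the unit interval the polylogarithm of order `-v` is the `v`-fold image of `x / (1 - x)`
under the Euler operator `x d/dx`. -/
lemma iterate_euler_eq_polylogNeg (v : ℕ) :
    ∀ z : ℝ, |z| < 1 →
      ((fun (f : ℝ → ℝ) (x : ℝ) => x * deriv f x)^[v] (fun x => x / (1 - x))) z =
        polylogNeg v z := by
  induction v with
  | zero =>
    intro z hz
    have h := (hasSum_geometric_of_abs_lt_one hz).mul_left z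
    simp only [Function.iterate_zero, id_eq, polylogNeg, pow_zero, one_mul]
    rw [div_eq_mul_inv, ← h.tsum_eq]
    exact tsum_congr fun k => by rw [pow_succ]; ring
  | succ v ih =>
    intro z hz
    rw [Function.iterate_succ_apply']
    have hev : ((fun (f : ℝ → ℝ) (x : ℝ) => x * deriv f x)^[v] (fun x => x / (1 - x)))
        =ᶠ[nhds z] polylogNeg v := by
      filter_upwards [(isOpen_lt continuous_abs continuous_const).mem_nhds hz] with x hx
      exact ih x hx
    simp only [hev.deriv_eq, (hasDerivAt_polylogNeg v hz).deriv, polylogNeg]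
    rw [← tsum_mul_left]
    exact tsum_congr fun k => by rw [pow_succ z]; ring

lemma hasSum_iterate_euler (v : ℕ) (z : ℝ) (hz : |z| < 1) :
    HasSum (fun k : ℕ => ((k : ℝ) + 1) ^ v * z ^ (k + 1))
      (((fun (f : ℝ → ℝ) (x : ℝ) => x * deriv f x)^[v] (fun x => x / (1 - x))) z) := by
  rw [iterate_euler_eq_polylogNeg v z hz]
  exact (summable_succ_pow_mul_geometric v hz).hasSum

lemma polylogNeg_two {p : ℝ} (hp : |p| < 1) : polylogNeg 2 p = p * (1 + p) / (1 - p) ^ 3 := by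
  have hp' : ‖p‖ < 1 := by simpa using hp
  have h2 := (hasSum_choose_mul_geometric_of_norm_lt_one 2 hp').mul_left (2 * p)
  have h1 := (hasSum_choose_mul_geometric_of_norm_lt_one 1 hp').mul_left p
  have h := h2.sub h1
  have h1p : (1 - p) ≠ 0 := by linarith [(abs_lt.1 hp).2] |> ne_of_gt
  have heq : 2 * p * (1 / (1 - p) ^ (2 + 1)) - p * (1 / (1 - p) ^ (1 + 1)) =
      p * (1 + p) / (1 - p) ^ 3 := by
    field_simp
    ring
  rw [← heq, ← h.tsum_eq]
  refine tsum_congr fun k => ?_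
  have hc : ((k + 2).choose 2 : ℝ) = ((k : ℝ) + 2) * (k + 1) / 2 := by
    rw [Nat.cast_choose_two]; push_cast; ring
  rw [hc, Nat.choose_one_right, pow_succ]
  push_cast
  ring

lemma polylogNeg_mono {p : ℝ} (hp0 : 0 ≤ p) (hp : p < 1) {v w : ℕ} (hvw : v ≤ w) :
    polylogNeg v p ≤ polylogNeg w p := by
  have hp' : |p| < 1 := by rwa [abs_of_nonneg hp0]
  refine (summable_succ_pow_mul_geometric v hp').tsum_le_tsum (fun k => ?_)
    (summable_succ_pow_mul_geometric w hp')
  gcongr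
  linarith [(Nat.cast_nonneg k : (0 : ℝ) ≤ k)]

/-- `ψ` dominates the mean of `R ^ 2` for `R` geometric of success probability `1 - p`, up to the
normalisation `(1 - p) / p`. -/
lemma le_psi {T : ℕ} {p : ℝ} (hp0 : 0 < p) (hp : p < 1 / 3) :
    (1 + p) / (1 - p) ^ 2 ≤ (1 - p) / p * psi T p := by
  have hp' : |p| < 1 := by rw [abs_of_pos hp0]; linarith
  have h1 : 0 < 1 - p := by linarith
  have h3 : 0 < 1 - 3 * p := by linarith
  have hle : polylogNeg 2 p ≤ psi T p := by
    have hT : 0 ≤ Ts2 T p := by unfold Ts2; positivity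
    have hm : 0 ≤ polylogNeg 4 p - polylogNeg 2 p :=
      sub_nonneg.2 (polylogNeg_mono hp0.le (by linarith) (by norm_num))
    unfold psi
    have : 0 ≤ 3 / (Ts2 T p + 1) * (polylogNeg 4 p - polylogNeg 2 p) := by positivity
    linarith
  calc (1 + p) / (1 - p) ^ 2 = (1 - p) / p * polylogNeg 2 p := by
        rw [polylogNeg_two hp']; field_simp
    _ ≤ _ := by gcongr

/-! ### Smooth functions and one recovery period along a fixed trajectory -/

section Smooth

variable {E : Type*} [NormedAddCommGroup E] [InnerProductSpace ℝ E]

/-- Jensen's inequality for the squared norm and the uniform weights. -/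
lemma norm_sq_average_le {K : ℕ} (hK : 0 < K) (v : Fin K → E) :
    ‖(1 / (K : ℝ)) • ∑ k, v k‖ ^ 2 ≤ (1 / (K : ℝ)) * ∑ k, ‖v k‖ ^ 2 := by
  have hK' : (0 : ℝ) < K := by exact_mod_cast hK
  have h1 : ‖∑ k, v k‖ ^ 2 ≤ K * ∑ k, ‖v k‖ ^ 2 := by
    have h := sq_sum_le_card_mul_sum_sq (s := (Finset.univ : Finset (Fin K))) (f := fun k => ‖v k‖)
    have h2 : ‖∑ k, v k‖ ^ 2 ≤ (∑ k, ‖v k‖) ^ 2 := by gcongr; exact norm_sum_le _ _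
    simpa using h2.trans h
  rw [norm_smul, mul_pow, Real.norm_of_nonneg (by positivity)]
  calc (1 / (K : ℝ)) ^ 2 * ‖∑ k, v k‖ ^ 2 ≤ (1 / (K : ℝ)) ^ 2 * (K * ∑ k, ‖v k‖ ^ 2) := by gcongr
    _ = _ := by field_simp

/-- Jensen's inequality for the squared norm and nonnegative weights. -/
lemma norm_sq_sum_smul_le {ι : Type*} (s : Finset ι) {w : ι → ℝ} (hw : ∀ j, 0 ≤ w j) (v : ι → E) :
    ‖∑ j ∈ s, w j • v j‖ ^ 2 ≤ (∑ j ∈ s, w j) * ∑ j ∈ s, w j * ‖v j‖ ^ 2 := by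
  have h1 : ‖∑ j ∈ s, w j • v j‖ ≤ ∑ j ∈ s, w j * ‖v j‖ :=
    (norm_sum_le _ _).trans_eq (Finset.sum_congr rfl fun j _ => by
      rw [norm_smul, Real.norm_of_nonneg (hw j)])
  calc ‖∑ j ∈ s, w j • v j‖ ^ 2 ≤ (∑ j ∈ s, w j * ‖v j‖) ^ 2 := by gcongr
    _ ≤ _ := by
      refine Finset.sum_sq_le_sum_mul_sum_of_sq_le_mul _ (fun j _ => hw j)
        (fun j _ => mul_nonneg (hw j) (sq_nonneg _)) fun j _ => le_of_eq (by ring)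

lemma norm_add_sq_le_two_mul (u v : E) : ‖u + v‖ ^ 2 ≤ 2 * ‖u‖ ^ 2 + 2 * ‖v‖ ^ 2 := by
  have := parallelogram_law_with_norm ℝ u v
  nlinarith [mul_self_nonneg ‖u - v‖]

variable [CompleteSpace E]

/-- The descent lemma: a function with `G`-Lipschitz gradient lies below its quadratic upper
models. -/
lemma le_add_inner_gradient_add_sq {f : E → ℝ} {G : ℝ} (hf : Differentiable ℝ f)
    (hG : ∀ x y, ‖gradient f x - gradient f y‖ ≤ G * ‖x - y‖) (x y : E) :
    f y ≤ f x + inner ℝ (gradient f x) (y - x) + G / 2 * ‖y - x‖ ^ 2 := by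
  set d := y - x with hd
  -- the gap to the quadratic model is antitone along the segment: its derivative is nonpositive
  let φ : ℝ → ℝ := fun t => f (x + t • d) - t * inner ℝ (gradient f x) d - G / 2 * ‖d‖ ^ 2 * t ^ 2
  have hφ : ∀ t, HasDerivAt φ (inner ℝ (gradient f (x + t • d) - gradient f x) d -
      G * ‖d‖ ^ 2 * t) t := by
    intro t
    have h1 : HasDerivAt (fun t : ℝ => x + t • d) d t := by
      simpa using ((hasDerivAt_id t).smul_const d).const_add x
    have h2 := (hf (x + t • d)).hasGradientAt.hasFDerivAt.comp_hasDerivAt t h1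
    have h3 := (hasDerivAt_id t).mul_const (inner ℝ (gradient f x) d)
    have h4 := ((hasDerivAt_pow 2 t).const_mul (G / 2 * ‖d‖ ^ 2))
    refine ((h2.sub h3).sub h4).congr_deriv ?_
    simp [inner_sub_left]
    ring
  have hanti : AntitoneOn φ (Set.Icc 0 1) := by
    refine antitoneOn_of_deriv_nonpos (convex_Icc 0 1)
      (fun t _ => (hφ t).continuousAt.continuousWithinAt)
      (fun t _ => (hφ t).differentiableAt.differentiableWithinAt) fun t ht => ?_
    rw [interior_Icc] at ht
    rw [(hφ t).deriv]
    have h1 := real_inner_le_norm (gradient f (x + t • d) - gradient f x) d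
    have h2 := hG (x + t • d) x
    rw [add_sub_cancel_left, norm_smul, Real.norm_of_nonneg ht.1.le] at h2
    nlinarith [mul_le_mul_of_nonneg_right h2 (norm_nonneg d)]
  have h01 := hanti (by simp) (by simp) (zero_le_one (α := ℝ))
  simp only [φ, one_smul, zero_smul] at h01
  have : x + d = y := by simp [hd]
  rw [this] at h01
  simp only [one_mul, one_pow, mul_one, zero_mul, sub_zero, add_zero, ne_eq, OfNat.ofNat_ne_zero,
    not_false_eq_true, zero_pow, mul_zero] at h01
  linarith

lemma gradient_average {K : ℕ} {L : Fin K → E → ℝ} (hL : ∀ k, Differentiable ℝ (L k)) (x : E) :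
    gradient (fun y => (1 / (K : ℝ)) * ∑ k, L k y) x =
      (1 / (K : ℝ)) • ∑ k, gradient (L k) x := by
  refine HasGradientAt.gradient ?_
  rw [hasGradientAt_iff_hasFDerivAt]
  have h : HasFDerivAt (fun y => ∑ k, L k y)
      (∑ k, (InnerProductSpace.toDual ℝ E) (gradient (L k) x)) x :=
    HasFDerivAt.fun_sum fun k _ => (hL k x).hasGradientAt.hasFDerivAt
  refine (h.const_mul (1 / (K : ℝ))).congr_fderiv ?_
  simp [map_sum]

/-- The decrease of a smooth function `f` over a step `-η (N + ∑ wⱼ bⱼ)` whose directions `bⱼ`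
approximate the gradient of `f` at the starting point and in which `N` is noise. The squares `‖bⱼ‖²`
produced by the quadratic term of the descent lemma are absorbed by the inner products. -/
lemma le_of_noisy_step {f : E → ℝ} {G η : ℝ} (hf : Differentiable ℝ f)
    (hG : ∀ x y, ‖gradient f x - gradient f y‖ ≤ G * ‖x - y‖) (hG0 : 0 ≤ G) (hη : 0 ≤ η)
    {w : ℕ → ℝ} (hw : ∀ j, 0 ≤ w j) (J : ℕ) (hstep : G * η * ∑ j ∈ Finset.range J, w j ≤ 1 / 2)
    (x N : E) (b : ℕ → E) :
    f (x - η • (N + ∑ j ∈ Finset.range J, w j • b j)) ≤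
      f x - η * inner ℝ (gradient f x) N
        - η / 2 * (∑ j ∈ Finset.range J, w j) * ‖gradient f x‖ ^ 2
        + η / 2 * ∑ j ∈ Finset.range J, w j * ‖b j - gradient f x‖ ^ 2
        + G * η ^ 2 * ‖N‖ ^ 2 := by
  set B := ∑ j ∈ Finset.range J, w j • b j with hB
  set W := ∑ j ∈ Finset.range J, w j with hW
  have h1 := le_add_inner_gradient_add_sq hf hG x (x - η • (N + B))
  have hd : x - η • (N + B) - x = -(η • (N + B)) := by abel
  rw [hd, norm_neg, inner_neg_right, inner_smul_right, inner_add_right, norm_smul,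
    Real.norm_of_nonneg hη, mul_pow] at h1
  have h2 : inner ℝ (gradient f x) B = ∑ j ∈ Finset.range J, w j * inner ℝ (gradient f x) (b j) := by
    rw [hB, inner_sum]
    exact Finset.sum_congr rfl fun j _ => inner_smul_right _ _ _
  have h3 : inner ℝ (gradient f x) B = 1 / 2 * (W * ‖gradient f x‖ ^ 2 +
      ∑ j ∈ Finset.range J, w j * ‖b j‖ ^ 2 -
      ∑ j ∈ Finset.range J, w j * ‖b j - gradient f x‖ ^ 2) := by
    rw [h2, hW, Finset.sum_mul, ← Finset.sum_add_distrib, ← Finset.sum_sub_distrib, Finset.mul_sum]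
    refine Finset.sum_congr rfl fun j _ => ?_
    have := norm_sub_sq_real (b j) (gradient f x)
    rw [this, real_inner_comm]
    ring
  have h4 : ‖N + B‖ ^ 2 ≤ 2 * ‖N‖ ^ 2 + 2 * (W * ∑ j ∈ Finset.range J, w j * ‖b j‖ ^ 2) :=
    (norm_add_sq_le_two_mul N B).trans (by gcongr; exact norm_sq_sum_smul_le _ hw b)
  have h5 : 0 ≤ ∑ j ∈ Finset.range J, w j * ‖b j‖ ^ 2 :=
    Finset.sum_nonneg fun j _ => mul_nonneg (hw j) (sq_nonneg _)
  have h6 : G / 2 * (η ^ 2 * ‖N + B‖ ^ 2) ≤ G / 2 * (η ^ 2 * (2 * ‖N‖ ^ 2 +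
      2 * (W * ∑ j ∈ Finset.range J, w j * ‖b j‖ ^ 2))) := by gcongr
  have h7 : η * (G * η * W) * ∑ j ∈ Finset.range J, w j * ‖b j‖ ^ 2 ≤
      η * (1 / 2) * ∑ j ∈ Finset.range J, w j * ‖b j‖ ^ 2 := by gcongr
  rw [h3] at h1
  linarith

end Smooth

/-! ### Stochastic gradient descent driven by fresh samples -/

section Sgd

variable {E Ξ : Type*} [NormedAddCommGroup E] [InnerProductSpace ℝ E]

/-- Iterates `x ← x - η wⱼ g(x, zⱼ)` started at `x`. -/
def sgdPath (η : ℝ) (w : ℕ → ℝ) (g : E → Ξ → E) (z : ℕ → Ξ) (x : E) : ℕ → E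
  | 0 => x
  | j + 1 => sgdPath η w g z x j - (η * w j) • g (sgdPath η w g z x j) (z j)

/-- The deviation of the `j`-th stochastic gradient along `sgdPath` from the mean field `h`. -/
def sgdNoise (h : E → E) (η : ℝ) (w : ℕ → ℝ) (g : E → Ξ → E) (z : ℕ → Ξ) (x : E) (j : ℕ) : E :=
  g (sgdPath η w g z x j) (z j) - h (sgdPath η w g z x j)

lemma sgdPath_eq_sub (h : E → E) (η : ℝ) (w : ℕ → ℝ) (g : E → Ξ → E) (z : ℕ → Ξ) (x : E) (J : ℕ) :
    sgdPath η w g z x J = x - η • (∑ j ∈ Finset.range J, w j • sgdNoise h η w g z x j +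
      ∑ j ∈ Finset.range J, w j • h (sgdPath η w g z x j)) := by
  induction J with
  | zero => simp [sgdPath]
  | succ J ih =>
    rw [Finset.sum_range_succ, Finset.sum_range_succ, sgdPath]
    nth_rewrite 1 [ih]
    simp only [sgdNoise, smul_add, smul_sub, mul_smul]
    abel

variable [MeasurableSpace E] [BorelSpace E] [SecondCountableTopology E] [MeasurableSpace Ξ]

/-- `g` is an unbiased stochastic version of the field `h` with variance at most `σ ^ 2` under the
sampling law `ν`. -/
structure IsStochasticField (h : E → E) (g : E → Ξ → E) (ν : Measure Ξ) (σ : ℝ) : Prop where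
  measurable : Measurable (fun p : E × Ξ => g p.1 p.2)
  integrable : ∀ x, Integrable (fun z => g x z) ν
  unbiased : ∀ x, ∫ z, g x z ∂ν = h x
  integrable_sq : ∀ x, Integrable (fun z => ‖g x z - h x‖ ^ 2) ν
  variance_le : ∀ x, ∫ z, ‖g x z - h x‖ ^ 2 ∂ν ≤ σ ^ 2

variable {Ω : Type*} {m : MeasurableSpace Ω} [mΩ : MeasurableSpace Ω]

/-- The samples `Z j` have law `ν`, are revealed along `ℱ`, and each of them is independent of the
information `ℱ j` available before it is drawn. -/
structure IsFreshSampling (Q : Measure Ω) (ν : Measure Ξ) (ℱ : ℕ → MeasurableSpace Ω)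
    (Z : ℕ → Ω → Ξ) : Prop where
  le : ∀ j, ℱ j ≤ mΩ
  mono : Monotone ℱ
  measurable : ∀ j, Measurable[ℱ (j + 1)] (Z j)
  indep : ∀ j, Indep (ℱ j) (MeasurableSpace.comap (Z j) inferInstance) Q
  law : ∀ j, Q.map (Z j) = ν

omit [BorelSpace E] [SecondCountableTopology E] [MeasurableSpace Ξ] [MeasurableSpace E] in
lemma MeasureTheory.MemLp.integrable_inner_of_two {Q : Measure Ω} {X Y : Ω → E} (hX : MemLp X 2 Q)
    (hY : MemLp Y 2 Q) : Integrable (fun ω => inner ℝ (X ω) (Y ω)) Q :=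
  (hX.norm.integrable_mul hY.norm).mono' (hX.1.inner hY.1)
    (.of_forall fun ω => norm_inner_le_norm (X ω) (Y ω))

variable {Q : Measure Ω} [IsProbabilityMeasure Q] {ν : Measure Ξ} {h : E → E} {g : E → Ξ → E}
  {σ : ℝ}

section OneSample

variable {X Y : Ω → E} {Z : Ω → Ξ}

/-- Conditionally on the past, the squared noise of a fresh stochastic gradient has mean at most
`σ ^ 2`. -/
lemma IsStochasticField.lintegral_noise_le (hg : IsStochasticField h g ν σ) (hh : Measurable h)
    (hm : m ≤ mΩ) (hX : Measurable[m] X) (hZ : Measurable Z)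
    (hind : Indep m (MeasurableSpace.comap Z inferInstance) Q) (hlaw : Q.map Z = ν) :
    ∫⁻ ω, ‖g (X ω) (Z ω) - h (X ω)‖ₑ ^ 2 ∂Q ≤ ENNReal.ofReal (σ ^ 2) := by
  have hX' : Measurable X := hX.mono hm le_rfl
  have hXZ : IndepFun X Z Q := indep_of_indep_of_le_left hind hX.comap_le
  have hmap := (indepFun_iff_map_prod_eq_prod_map_map hX'.aemeasurable hZ.aemeasurable).1 hXZ
  have : IsProbabilityMeasure (Q.map X) := Measure.isProbabilityMeasure_map hX'.aemeasurable
  have : IsProbabilityMeasure (Q.map Z) := Measure.isProbabilityMeasure_map hZ.aemeasurable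
  have hF : Measurable (fun p : E × Ξ => ‖g p.1 p.2 - h p.1‖ₑ ^ 2) :=
    ((hg.measurable.sub (hh.comp measurable_fst)).enorm.pow_const 2)
  calc ∫⁻ ω, ‖g (X ω) (Z ω) - h (X ω)‖ₑ ^ 2 ∂Q
      = ∫⁻ p, ‖g p.1 p.2 - h p.1‖ₑ ^ 2 ∂(Q.map fun ω => (X ω, Z ω)) :=
        (lintegral_map hF (hX'.prodMk hZ)).symm
    _ = ∫⁻ x, ∫⁻ z, ‖g x z - h x‖ₑ ^ 2 ∂(Q.map Z) ∂(Q.map X) := by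
        rw [hmap, lintegral_prod _ hF.aemeasurable]
    _ ≤ ∫⁻ _, ENNReal.ofReal (σ ^ 2) ∂(Q.map X) := by
        refine lintegral_mono fun x => ?_
        rw [hlaw]
        have h1 := ofReal_integral_eq_lintegral_ofReal (hg.integrable_sq x)
          (.of_forall fun z => sq_nonneg _)
        have h2 : ∀ z, ‖g x z - h x‖ₑ ^ 2 = ENNReal.ofReal (‖g x z - h x‖ ^ 2) := fun z => by
          rw [ENNReal.ofReal_pow (norm_nonneg _), ofReal_norm]
        simp only [h2]
        rw [← h1]
        exact ENNReal.ofReal_le_ofReal (hg.variance_le x)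
    _ = ENNReal.ofReal (σ ^ 2) := by simp

lemma IsStochasticField.memLp_noise (hg : IsStochasticField h g ν σ) (hh : Measurable h)
    (hm : m ≤ mΩ) (hX : Measurable[m] X) (hZ : Measurable Z)
    (hind : Indep m (MeasurableSpace.comap Z inferInstance) Q) (hlaw : Q.map Z = ν) :
    MemLp (fun ω => g (X ω) (Z ω) - h (X ω)) 2 Q := by
  have hX' : Measurable X := hX.mono hm le_rfl
  have hmeas : Measurable (fun ω => g (X ω) (Z ω) - h (X ω)) :=
    (hg.measurable.comp (hX'.prodMk hZ)).sub (hh.comp hX')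
  rw [memLp_two_iff_integrable_sq_norm hmeas.aestronglyMeasurable]
  refine ⟨(hmeas.norm.pow_const 2).aestronglyMeasurable, ?_⟩
  rw [hasFiniteIntegral_iff_enorm]
  simp only [enorm_pow, enorm_norm]
  exact (hg.lintegral_noise_le hh hm hX hZ hind hlaw).trans_lt ENNReal.ofReal_lt_top

lemma IsStochasticField.integral_noise_le (hg : IsStochasticField h g ν σ) (hh : Measurable h)
    (hm : m ≤ mΩ) (hX : Measurable[m] X) (hZ : Measurable Z)
    (hind : Indep m (MeasurableSpace.comap Z inferInstance) Q) (hlaw : Q.map Z = ν) :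
    ∫ ω, ‖g (X ω) (Z ω) - h (X ω)‖ ^ 2 ∂Q ≤ σ ^ 2 := by
  have hL := hg.memLp_noise hh hm hX hZ hind hlaw
  rw [integral_eq_lintegral_of_nonneg_ae (.of_forall fun _ => sq_nonneg _)
    (hL.1.norm.pow 2)]
  refine ENNReal.toReal_le_of_le_ofReal (sq_nonneg σ) ?_
  refine le_trans (le_of_eq (lintegral_congr fun ω => ?_))
    (hg.lintegral_noise_le hh hm hX hZ hind hlaw)
  rw [ENNReal.ofReal_pow (norm_nonneg _), ofReal_norm]

/-- The noise of a fresh stochastic gradient is orthogonal to the past. -/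
lemma IsStochasticField.integral_inner_noise [CompleteSpace E]
    (hg : IsStochasticField h g ν σ) (hh : Measurable h)
    (hm : m ≤ mΩ) (hX : Measurable[m] X) (hZ : Measurable Z)
    (hind : Indep m (MeasurableSpace.comap Z inferInstance) Q) (hlaw : Q.map Z = ν)
    (hY : Measurable[m] Y) (hY2 : MemLp Y 2 Q) :
    ∫ ω, inner ℝ (Y ω) (g (X ω) (Z ω) - h (X ω)) ∂Q = 0 := by
  have hX' : Measurable X := hX.mono hm le_rfl
  have hY' : Measurable Y := hY.mono hm le_rfl
  have hXY : Measurable[m] (fun ω => (X ω, Y ω)) := hX.prodMk hY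
  have hXY' : Measurable (fun ω => (X ω, Y ω)) := hX'.prodMk hY'
  have hXYZ : IndepFun (fun ω => (X ω, Y ω)) Z Q := indep_of_indep_of_le_left hind hXY.comap_le
  have hmap := (indepFun_iff_map_prod_eq_prod_map_map hXY'.aemeasurable hZ.aemeasurable).1 hXYZ
  have : IsProbabilityMeasure (Q.map fun ω => (X ω, Y ω)) :=
    Measure.isProbabilityMeasure_map hXY'.aemeasurable
  have hpm : IsProbabilityMeasure (Q.map Z) := Measure.isProbabilityMeasure_map hZ.aemeasurable
  have hF : Measurable (fun p : (E × E) × Ξ => inner ℝ p.1.2 (g p.1.1 p.2 - h p.1.1)) := by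
    refine (measurable_fst.snd).inner ((hg.measurable.comp
      (measurable_fst.fst.prodMk measurable_snd)).sub (hh.comp measurable_fst.fst))
  have hint : Integrable (fun ω => inner ℝ (Y ω) (g (X ω) (Z ω) - h (X ω))) Q :=
    hY2.integrable_inner_of_two (hg.memLp_noise hh hm hX hZ hind hlaw)
  have hint' : Integrable (fun p : (E × E) × Ξ => inner ℝ p.1.2 (g p.1.1 p.2 - h p.1.1))
      (Q.map fun ω => ((X ω, Y ω), Z ω)) :=
    (integrable_map_measure hF.aestronglyMeasurable (hXY'.prodMk hZ).aemeasurable).2 hint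
  have h1 : ∫ ω, inner ℝ (Y ω) (g (X ω) (Z ω) - h (X ω)) ∂Q =
      ∫ p, inner ℝ p.1.2 (g p.1.1 p.2 - h p.1.1) ∂(Q.map fun ω => ((X ω, Y ω), Z ω)) :=
    (integral_map (hXY'.prodMk hZ).aemeasurable hF.aestronglyMeasurable).symm
  rw [h1, hmap, integral_prod _ (hmap ▸ hint')]
  refine integral_eq_zero_of_ae (.of_forall fun p => ?_)
  rw [hlaw] at hpm ⊢
  simp only [Pi.zero_apply]
  have hp : Integrable (fun z => g p.1 z - h p.1) ν := (hg.integrable p.1).sub (integrable_const _)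
  rw [integral_inner hp, integral_sub (hg.integrable p.1) (integrable_const _), hg.unbiased]
  simp

end OneSample

section Path

variable {G η : ℝ} {w : ℕ → ℝ} {ℱ : ℕ → MeasurableSpace Ω} {Z : ℕ → Ω → Ξ} {X : Ω → E}

omit [InnerProductSpace ℝ E] [SecondCountableTopology E] [MeasurableSpace E] [BorelSpace E]
  [MeasurableSpace Ξ] in
lemma MeasureTheory.MemLp.comp_lipschitz {F : E → E} (hX : MemLp X 2 Q)
    (hF : ∀ x y, ‖F x - F y‖ ≤ G * ‖x - y‖) : MemLp (fun ω => F (X ω)) 2 Q := by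
  have hlip : LipschitzWith G.toNNReal F := LipschitzWith.of_dist_le' fun x y => by
    simpa only [dist_eq_norm] using hF x y
  have h1 : MemLp (fun ω => ‖F 0‖ + G * ‖X ω‖) 2 Q :=
    (memLp_const (‖F 0‖)).add (hX.norm.const_mul G)
  refine h1.mono (hlip.continuous.comp_aestronglyMeasurable hX.1) (.of_forall fun ω => ?_)
  have h2 := hF (X ω) 0
  have h3 := norm_le_norm_add_norm_sub (F 0) (F (X ω))
  rw [norm_sub_rev] at h3
  rw [sub_zero] at h2
  calc ‖F (X ω)‖ ≤ ‖F 0‖ + G * ‖X ω‖ := by linarith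
    _ ≤ ‖‖F 0‖ + G * ‖X ω‖‖ := Real.le_norm_self _

omit [SecondCountableTopology E] [InnerProductSpace ℝ E] in
lemma measurable_of_lipschitz_norm (hh : ∀ x y, ‖h x - h y‖ ≤ G * ‖x - y‖) : Measurable h :=
  (LipschitzWith.of_dist_le' (K := G) fun x y => by
    simpa only [dist_eq_norm] using hh x y).continuous.measurable

omit [IsProbabilityMeasure Q] in
lemma IsFreshSampling.measurable_sgdPath (hZ : IsFreshSampling Q ν ℱ Z)
    (hg : IsStochasticField h g ν σ) (hX : Measurable[ℱ 0] X) (j : ℕ) :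
    Measurable[ℱ j] (fun ω => sgdPath η w g (fun i => Z i ω) (X ω) j) := by
  induction j with
  | zero => exact hX
  | succ j ih =>
    have ih' := ih.mono (hZ.mono j.le_succ) le_rfl
    simp only [sgdPath]
    exact ih'.sub ((hg.measurable.comp (ih'.prodMk (hZ.measurable j))).const_smul _)

omit [IsProbabilityMeasure Q] in
lemma IsFreshSampling.measurable_sample (hZ : IsFreshSampling Q ν ℱ Z) (j : ℕ) :
    Measurable (Z j) := (hZ.measurable j).mono (hZ.le _) le_rfl

lemma IsFreshSampling.memLp_sgdNoise (hZ : IsFreshSampling Q ν ℱ Z)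
    (hg : IsStochasticField h g ν σ) (hh : ∀ x y, ‖h x - h y‖ ≤ G * ‖x - y‖)
    (hX : Measurable[ℱ 0] X) (j : ℕ) :
    MemLp (fun ω => sgdNoise h η w g (fun i => Z i ω) (X ω) j) 2 Q :=
  hg.memLp_noise (measurable_of_lipschitz_norm hh) (hZ.le j) (hZ.measurable_sgdPath hg hX j)
    (hZ.measurable_sample j) (hZ.indep j) (hZ.law j)

lemma IsFreshSampling.memLp_sgdPath (hZ : IsFreshSampling Q ν ℱ Z)
    (hg : IsStochasticField h g ν σ) (hh : ∀ x y, ‖h x - h y‖ ≤ G * ‖x - y‖)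
    (hX : Measurable[ℱ 0] X) (hX2 : MemLp X 2 Q) (j : ℕ) :
    MemLp (fun ω => sgdPath η w g (fun i => Z i ω) (X ω) j) 2 Q := by
  induction j with
  | zero => exact hX2
  | succ j ih =>
    have h1 := hZ.memLp_sgdNoise (η := η) (w := w) hg hh hX j
    have h2 := ih.comp_lipschitz hh
    have h3 := ih.sub ((h1.add h2).const_smul (η * w j))
    refine h3.ae_eq (.of_forall fun ω => ?_)
    simp only [sgdPath, sgdNoise, Pi.sub_apply, Pi.add_apply, Pi.smul_apply, sub_add_cancel]

omit [IsProbabilityMeasure Q] in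
lemma IsFreshSampling.measurable_sum_sgdNoise (hZ : IsFreshSampling Q ν ℱ Z)
    (hg : IsStochasticField h g ν σ) (hh : ∀ x y, ‖h x - h y‖ ≤ G * ‖x - y‖)
    (hX : Measurable[ℱ 0] X) (J : ℕ) :
    Measurable[ℱ J] (fun ω => ∑ j ∈ Finset.range J,
      w j • sgdNoise h η w g (fun i => Z i ω) (X ω) j) := by
  refine Finset.measurable_fun_sum _ fun j hj => ?_
  have hj' : j + 1 ≤ J := Finset.mem_range.1 hj
  have h1 := (hZ.measurable_sgdPath (η := η) (w := w) hg hX j).mono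
    (hZ.mono (j.le_succ.trans hj')) le_rfl
  have h2 := (hZ.measurable j).mono (hZ.mono hj') le_rfl
  exact ((hg.measurable.comp (h1.prodMk h2)).sub
    ((measurable_of_lipschitz_norm hh).comp h1)).const_smul _

lemma IsFreshSampling.memLp_sum_sgdNoise (hZ : IsFreshSampling Q ν ℱ Z)
    (hg : IsStochasticField h g ν σ) (hh : ∀ x y, ‖h x - h y‖ ≤ G * ‖x - y‖)
    (hX : Measurable[ℱ 0] X) (J : ℕ) :
    MemLp (fun ω => ∑ j ∈ Finset.range J,
      w j • sgdNoise h η w g (fun i => Z i ω) (X ω) j) 2 Q :=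
  memLp_finsetSum _ fun j _ => (hZ.memLp_sgdNoise hg hh hX j).const_smul _

/-- The noise terms along the path are orthogonal martingale increments, so that the variances
add up. -/
lemma IsFreshSampling.integral_norm_sq_sum_sgdNoise_le [CompleteSpace E]
    (hZ : IsFreshSampling Q ν ℱ Z)
    (hg : IsStochasticField h g ν σ) (hh : ∀ x y, ‖h x - h y‖ ≤ G * ‖x - y‖)
    (hX : Measurable[ℱ 0] X) (J : ℕ) :
    ∫ ω, ‖∑ j ∈ Finset.range J, w j • sgdNoise h η w g (fun i => Z i ω) (X ω) j‖ ^ 2 ∂Q ≤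
      σ ^ 2 * ∑ j ∈ Finset.range J, w j ^ 2 := by
  induction J with
  | zero => simp
  | succ J ih =>
    let S : Ω → E := fun ω => ∑ j ∈ Finset.range J, w j • sgdNoise h η w g (fun i => Z i ω) (X ω) j
    let n : Ω → E := fun ω => sgdNoise h η w g (fun i => Z i ω) (X ω) J
    have hS : MemLp S 2 Q := hZ.memLp_sum_sgdNoise hg hh hX J
    have hn : MemLp n 2 Q := hZ.memLp_sgdNoise hg hh hX J
    have hSm : Measurable[ℱ J] S := hZ.measurable_sum_sgdNoise hg hh hX J
    -- the partial sum of the earlier noise terms is known before the sample `Z J` is drawn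
    have hcross : ∫ ω, inner ℝ (S ω) (n ω) ∂Q = 0 :=
      hg.integral_inner_noise (measurable_of_lipschitz_norm hh) (hZ.le J)
        (hZ.measurable_sgdPath hg hX J) (hZ.measurable_sample J) (hZ.indep J) (hZ.law J) hSm hS
    have hvar : ∫ ω, ‖n ω‖ ^ 2 ∂Q ≤ σ ^ 2 :=
      hg.integral_noise_le (measurable_of_lipschitz_norm hh) (hZ.le J)
        (hZ.measurable_sgdPath hg hX J) (hZ.measurable_sample J) (hZ.indep J) (hZ.law J)
    have hexp : ∀ ω, ‖S ω + w J • n ω‖ ^ 2 =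
        ‖S ω‖ ^ 2 + 2 * w J * inner ℝ (S ω) (n ω) + w J ^ 2 * ‖n ω‖ ^ 2 := fun ω => by
      rw [norm_add_sq_real, inner_smul_right, norm_smul, mul_pow, Real.norm_eq_abs, sq_abs]
      ring
    have hiS : Integrable (fun ω => ‖S ω‖ ^ 2) Q := (memLp_two_iff_integrable_sq_norm hS.1).1 hS
    have hin : Integrable (fun ω => ‖n ω‖ ^ 2) Q := (memLp_two_iff_integrable_sq_norm hn.1).1 hn
    have hic := hS.integrable_inner_of_two hn
    calc ∫ ω, ‖∑ j ∈ Finset.range (J + 1),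
            w j • sgdNoise h η w g (fun i => Z i ω) (X ω) j‖ ^ 2 ∂Q
        = ∫ ω, (‖S ω‖ ^ 2 + 2 * w J * inner ℝ (S ω) (n ω) + w J ^ 2 * ‖n ω‖ ^ 2) ∂Q := by
          refine integral_congr_ae (.of_forall fun ω => ?_)
          simp only [Finset.sum_range_succ]
          exact hexp ω
      _ = ∫ ω, ‖S ω‖ ^ 2 ∂Q + w J ^ 2 * ∫ ω, ‖n ω‖ ^ 2 ∂Q := by
          have h2 := hic.const_mul (2 * w J)
          have h3 : Integrable (fun ω => ‖S ω‖ ^ 2 + 2 * w J * inner ℝ (S ω) (n ω)) Q := hiS.add h2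
          rw [integral_add h3 (hin.const_mul _), integral_add hiS h2, integral_const_mul,
            integral_const_mul, hcross]
          ring
      _ ≤ σ ^ 2 * ∑ j ∈ Finset.range J, w j ^ 2 + w J ^ 2 * σ ^ 2 := by gcongr
      _ = _ := by rw [Finset.sum_range_succ]; ring

/-- The client drift: over a period of small total step size the expected squared distance to the
starting point stays below a fixed bound, by induction along the path. -/
lemma IsFreshSampling.integral_norm_sq_sgdPath_sub_le [CompleteSpace E]
    (hZ : IsFreshSampling Q ν ℱ Z)
    (hg : IsStochasticField h g ν σ) (hh : ∀ x y, ‖h x - h y‖ ≤ G * ‖x - y‖)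
    (hX : Measurable[ℱ 0] X) (hX2 : MemLp X 2 Q) (hw : ∀ j, 0 ≤ w j) (N : ℕ)
    (hstep : 8 * η ^ 2 * G ^ 2 * (∑ j ∈ Finset.range N, w j) ^ 2 ≤ 1) (J : ℕ) (hJ : J ≤ N) :
    ∫ ω, ‖sgdPath η w g (fun i => Z i ω) (X ω) J - X ω‖ ^ 2 ∂Q ≤
      4 * η ^ 2 * σ ^ 2 * ∑ j ∈ Finset.range N, w j ^ 2 +
        8 * η ^ 2 * (∑ j ∈ Finset.range N, w j) ^ 2 * ∫ ω, ‖h (X ω)‖ ^ 2 ∂Q := by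
  induction J using Nat.strong_induction_on with
  | _ J ih =>
  set W := ∑ j ∈ Finset.range N, w j with hW
  set V := ∑ j ∈ Finset.range N, w j ^ 2 with hV
  set H := ∫ ω, ‖h (X ω)‖ ^ 2 ∂Q with hH
  set C := 4 * η ^ 2 * σ ^ 2 * V + 8 * η ^ 2 * W ^ 2 * H with hC
  let x : ℕ → Ω → E := fun j ω => sgdPath η w g (fun i => Z i ω) (X ω) j
  let n : ℕ → Ω → E := fun j ω => sgdNoise h η w g (fun i => Z i ω) (X ω) j
  have hx2 : ∀ j, MemLp (fun ω => x j ω - X ω) 2 Q := fun j =>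
    (hZ.memLp_sgdPath hg hh hX hX2 j).sub hX2
  have hxi : ∀ j, Integrable (fun ω => ‖x j ω - X ω‖ ^ 2) Q := fun j =>
    (memLp_two_iff_integrable_sq_norm (hx2 j).1).1 (hx2 j)
  have hhX := hX2.comp_lipschitz hh
  have hhi : Integrable (fun ω => ‖h (X ω)‖ ^ 2) Q :=
    (memLp_two_iff_integrable_sq_norm hhX.1).1 hhX
  have hN2 : MemLp (fun ω => ∑ j ∈ Finset.range J, w j • n j ω) 2 Q :=
    hZ.memLp_sum_sgdNoise hg hh hX J
  have hNi : Integrable (fun ω => ‖∑ j ∈ Finset.range J, w j • n j ω‖ ^ 2) Q :=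
    (memLp_two_iff_integrable_sq_norm hN2.1).1 hN2
  have hsub : Finset.range J ⊆ Finset.range N := Finset.range_mono hJ
  have hWJ : ∑ j ∈ Finset.range J, w j ≤ W :=
    Finset.sum_le_sum_of_subset_of_nonneg hsub fun j _ _ => hw j
  have hWJ0 : 0 ≤ ∑ j ∈ Finset.range J, w j := Finset.sum_nonneg fun j _ => hw j
  have hVJ : ∑ j ∈ Finset.range J, w j ^ 2 ≤ V :=
    Finset.sum_le_sum_of_subset_of_nonneg hsub fun j _ _ => sq_nonneg _
  have hV0 : 0 ≤ V := Finset.sum_nonneg fun j _ => sq_nonneg _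
  have hH0 : 0 ≤ H := integral_nonneg fun ω => sq_nonneg _
  have hC0 : 0 ≤ C := by positivity
  have hpt : ∀ ω, ‖x J ω - X ω‖ ^ 2 ≤
      2 * η ^ 2 * ‖∑ j ∈ Finset.range J, w j • n j ω‖ ^ 2 +
      2 * η ^ 2 * (W * ∑ j ∈ Finset.range J,
        w j * (2 * ‖h (X ω)‖ ^ 2 + 2 * G ^ 2 * ‖x j ω - X ω‖ ^ 2)) := fun ω => by
    have h1 : x J ω - X ω = -(η • (∑ j ∈ Finset.range J, w j • n j ω +
        ∑ j ∈ Finset.range J, w j • h (x j ω))) := by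
      simp only [x, n]
      rw [sgdPath_eq_sub h]
      abel
    have h2 : ∀ j, ‖h (x j ω)‖ ^ 2 ≤ 2 * ‖h (X ω)‖ ^ 2 + 2 * G ^ 2 * ‖x j ω - X ω‖ ^ 2 :=
      fun j => by
      have h3 := norm_add_sq_le_two_mul (h (X ω)) (h (x j ω) - h (X ω))
      rw [add_sub_cancel] at h3
      have h4 : ‖h (x j ω) - h (X ω)‖ ^ 2 ≤ (G * ‖x j ω - X ω‖) ^ 2 := by
        gcongr; exact hh _ _
      rw [mul_pow] at h4
      linarith
    have h5 : ‖∑ j ∈ Finset.range J, w j • h (x j ω)‖ ^ 2 ≤ W * ∑ j ∈ Finset.range J,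
        w j * (2 * ‖h (X ω)‖ ^ 2 + 2 * G ^ 2 * ‖x j ω - X ω‖ ^ 2) := by
      refine (norm_sq_sum_smul_le _ hw _).trans ?_
      gcongr with j _
      · exact Finset.sum_nonneg fun j _ => mul_nonneg (hw j) (sq_nonneg _)
      · exact hWJ0.trans hWJ
      · exact hw _
      · exact h2 _
    rw [h1, norm_neg, norm_smul, mul_pow, Real.norm_eq_abs, sq_abs]
    have h6 := norm_add_sq_le_two_mul (∑ j ∈ Finset.range J, w j • n j ω)
      (∑ j ∈ Finset.range J, w j • h (x j ω))
    have h7 := mul_le_mul_of_nonneg_left (h6.trans (add_le_add_right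
      (mul_le_mul_of_nonneg_left h5 zero_le_two) _)) (sq_nonneg η)
    linarith
  have hi1 : ∀ j, Integrable (fun ω =>
      w j * (2 * ‖h (X ω)‖ ^ 2 + 2 * G ^ 2 * ‖x j ω - X ω‖ ^ 2)) Q := fun j =>
    ((hhi.const_mul 2).add ((hxi j).const_mul (2 * G ^ 2))).const_mul (w j)
  have hint := integral_mono (hxi J) ((hNi.const_mul (2 * η ^ 2)).add
    (((integrable_finsetSum (Finset.range J) fun j _ => hi1 j).const_mul W).const_mul (2 * η ^ 2)))
    hpt
  simp only [Pi.add_apply] at hint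
  rw [integral_add (hNi.const_mul (2 * η ^ 2))
    (((integrable_finsetSum (Finset.range J) fun j _ => hi1 j).const_mul W).const_mul (2 * η ^ 2)),
    integral_const_mul, integral_const_mul, integral_const_mul,
    integral_finsetSum _ fun j _ => hi1 j] at hint
  have hnoise : ∫ ω, ‖∑ j ∈ Finset.range J, w j • n j ω‖ ^ 2 ∂Q ≤ σ ^ 2 * V :=
    (hZ.integral_norm_sq_sum_sgdNoise_le hg hh hX J).trans (by gcongr)
  have hdrift : ∑ j ∈ Finset.range J,
      ∫ ω, w j * (2 * ‖h (X ω)‖ ^ 2 + 2 * G ^ 2 * ‖x j ω - X ω‖ ^ 2) ∂Q ≤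
      W * (2 * H + 2 * G ^ 2 * C) := by
    have h1 : ∀ j ∈ Finset.range J,
        ∫ ω, w j * (2 * ‖h (X ω)‖ ^ 2 + 2 * G ^ 2 * ‖x j ω - X ω‖ ^ 2) ∂Q ≤
        w j * (2 * H + 2 * G ^ 2 * C) := fun j hj => by
      have hjJ := Finset.mem_range.1 hj
      have h2 := ih j hjJ (hjJ.le.trans hJ)
      rw [integral_const_mul, integral_add (hhi.const_mul 2) ((hxi j).const_mul (2 * G ^ 2)),
        integral_const_mul, integral_const_mul]
      have := hw j
      gcongr
    refine (Finset.sum_le_sum h1).trans ?_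
    rw [← Finset.sum_mul]
    gcongr
  have hW0 : 0 ≤ W := hWJ0.trans hWJ
  calc ∫ ω, ‖x J ω - X ω‖ ^ 2 ∂Q
      ≤ 2 * η ^ 2 * (σ ^ 2 * V) + 2 * η ^ 2 * (W * (W * (2 * H + 2 * G ^ 2 * C))) := by
        refine hint.trans ?_
        gcongr
    _ = C / 2 + (8 * η ^ 2 * G ^ 2 * W ^ 2) * (C / 2) := by rw [hC]; ring
    _ ≤ C / 2 + 1 * (C / 2) := by gcongr
    _ = C := by ring

end Path

end Sgd

/-! ### One recovery period -/

section Period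

variable {K D : ℕ} {L : Fin K → EuclideanSpace ℝ (Fin D) → ℝ} {G Lstar σ β κ η : ℝ}

lemma average_const {M : Type*} [AddCommGroup M] [Module ℝ M] (hK : 0 < K) (c : M) :
    (1 / (K : ℝ)) • ∑ _k : Fin K, c = c := by
  have hK' : (K : ℝ) ≠ 0 := by exact_mod_cast hK.ne'
  rw [Finset.sum_const, Finset.card_univ, Fintype.card_fin, ← Nat.cast_smul_eq_nsmul ℝ, smul_smul,
    one_div_mul_cancel hK', one_smul]

lemma average_mono {u v : Fin K → ℝ} (h : ∀ k, u k ≤ v k) :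
    (1 / (K : ℝ)) * ∑ k, u k ≤ (1 / (K : ℝ)) * ∑ k, v k := by
  gcongr with k
  exact h k

lemma Smoothness.le_globalLoss (hL : Smoothness L G Lstar) (hK : 0 < K)
    (x : EuclideanSpace ℝ (Fin D)) : Lstar ≤ globalLoss L x := by
  rw [← average_const hK Lstar]
  exact average_mono fun k => hL.lower_bound k x

lemma Smoothness.gradient_globalLoss (hL : Smoothness L G Lstar) (x : EuclideanSpace ℝ (Fin D)) :
    gradient (globalLoss L) x = (1 / (K : ℝ)) • ∑ k, gradient (L k) x :=
  gradient_average hL.differentiable x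

lemma Smoothness.differentiable_globalLoss (hL : Smoothness L G Lstar) :
    Differentiable ℝ (globalLoss L) := by
  unfold globalLoss
  exact (Differentiable.fun_sum fun k _ => hL.differentiable k).const_mul _

lemma Smoothness.norm_gradient_globalLoss_sub_le (hL : Smoothness L G Lstar) (hK : 0 < K)
    (x y : EuclideanSpace ℝ (Fin D)) :
    ‖gradient (globalLoss L) x - gradient (globalLoss L) y‖ ≤ G * ‖x - y‖ := by
  rw [hL.gradient_globalLoss, hL.gradient_globalLoss, ← smul_sub, ← Finset.sum_sub_distrib,
    norm_smul, Real.norm_of_nonneg (by positivity)]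
  calc (1 / (K : ℝ)) * ‖∑ k, (gradient (L k) x - gradient (L k) y)‖
      ≤ (1 / (K : ℝ)) * ∑ _k : Fin K, G * ‖x - y‖ := by
        gcongr
        exact (norm_sum_le _ _).trans (Finset.sum_le_sum fun k _ => hL.lipschitz k x y)
    _ = G * ‖x - y‖ := average_const (M := ℝ) hK _

variable {Ξ Ω : Type*} [MeasurableSpace Ξ] [mΩ : MeasurableSpace Ω] {Q : Measure Ω}
  [IsProbabilityMeasure Q] {ν : Fin K → Measure Ξ}
  {g : Fin K → EuclideanSpace ℝ (Fin D) → Ξ → EuclideanSpace ℝ (Fin D)}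

lemma UnbiasedBoundedVariance.isStochasticField (hg : UnbiasedBoundedVariance L g ν σ)
    (k : Fin K) : IsStochasticField (gradient (L k)) (g k) (ν k) σ :=
  ⟨hg.measurable k, hg.integrable k, hg.unbiased k, hg.integrable_sq k, hg.variance_le k⟩

/-- By the descent lemma a smooth function bounded below grows at most quadratically, so that its
values at a square integrable point are integrable. -/
lemma Smoothness.integrable_globalLoss (hL : Smoothness L G Lstar) (hK : 0 < K) (hG : 0 ≤ G)
    {X : Ω → EuclideanSpace ℝ (Fin D)} (hX : MemLp X 2 Q) :
    Integrable (fun ω => globalLoss L (X ω)) Q := by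
  set F := globalLoss L with hF
  have hX1 : Integrable X Q := hX.integrable (by norm_num)
  have hX2 : Integrable (fun ω => ‖X ω‖ ^ 2) Q := (memLp_two_iff_integrable_sq_norm hX.1).1 hX
  have hdom : Integrable (fun ω => |Lstar| + |F 0| + ‖gradient F 0‖ * ‖X ω‖ +
      G / 2 * ‖X ω‖ ^ 2) Q :=
    ((integrable_const (|Lstar| + |F 0|)).add (hX1.norm.const_mul _)).add (hX2.const_mul _)
  refine hdom.mono' (hL.differentiable_globalLoss.continuous.comp_aestronglyMeasurable hX.1)
    (.of_forall fun ω => ?_)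
  have h1 := hL.le_globalLoss hK (X ω)
  have h2 := le_add_inner_gradient_add_sq hL.differentiable_globalLoss
    (hL.norm_gradient_globalLoss_sub_le hK) 0 (X ω)
  rw [sub_zero, ← hF] at h2
  have h3 := real_inner_le_norm (gradient F 0) (X ω)
  have h4 : 0 ≤ ‖gradient F 0‖ * ‖X ω‖ := by positivity
  have h5 : 0 ≤ G / 2 * ‖X ω‖ ^ 2 := by positivity
  rw [Real.norm_eq_abs, abs_le]
  constructor <;> linarith [neg_abs_le Lstar, le_abs_self (F 0), abs_nonneg (F 0),
    abs_nonneg Lstar]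

/-- The model recovered after `J` local iterations of every client started at `x`. -/
noncomputable def periodEnd (η : ℝ) (w : ℕ → ℝ)
    (g : Fin K → EuclideanSpace ℝ (Fin D) → Ξ → EuclideanSpace ℝ (Fin D))
    (z : ℕ → Fin K → Ξ) (x : EuclideanSpace ℝ (Fin D)) (J : ℕ) : EuclideanSpace ℝ (Fin D) :=
  x + (1 / (K : ℝ)) • ∑ k, (sgdPath η w (g k) (fun j => z j k) x J - x)

omit [MeasurableSpace Ξ] in
lemma periodEnd_eq_sub (L : Fin K → EuclideanSpace ℝ (Fin D) → ℝ) (w : ℕ → ℝ)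
    (z : ℕ → Fin K → Ξ) (x : EuclideanSpace ℝ (Fin D)) (J : ℕ) :
    periodEnd η w g z x J = x - η •
      ((1 / (K : ℝ)) • ∑ k, ∑ j ∈ Finset.range J,
          w j • sgdNoise (gradient (L k)) η w (g k) (fun j => z j k) x j +
        ∑ j ∈ Finset.range J, w j •
          ((1 / (K : ℝ)) • ∑ k, gradient (L k) (sgdPath η w (g k) (fun j => z j k) x j))) := by
  have h1 : ∀ k, sgdPath η w (g k) (fun j => z j k) x J - x = -(η •
      (∑ j ∈ Finset.range J, w j • sgdNoise (gradient (L k)) η w (g k) (fun j => z j k) x j +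
      ∑ j ∈ Finset.range J, w j • gradient (L k) (sgdPath η w (g k) (fun j => z j k) x j))) :=
    fun k => by
    rw [sgdPath_eq_sub (gradient (L k))]
    abel
  have h2 : ∑ j ∈ Finset.range J, w j •
      ((1 / (K : ℝ)) • ∑ k, gradient (L k) (sgdPath η w (g k) (fun j => z j k) x j)) =
      (1 / (K : ℝ)) • ∑ k, ∑ j ∈ Finset.range J,
        w j • gradient (L k) (sgdPath η w (g k) (fun j => z j k) x j) := by
    rw [Finset.sum_comm, Finset.smul_sum]
    refine Finset.sum_congr rfl fun j _ => ?_
    rw [smul_comm, Finset.smul_sum]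
  simp only [periodEnd, h1]
  rw [h2, ← smul_add, ← Finset.sum_add_distrib, Finset.sum_neg_distrib, ← Finset.smul_sum,
    smul_neg, smul_comm, sub_eq_add_neg]

variable {w : ℕ → ℝ} {ℱ : ℕ → MeasurableSpace Ω} {Z : ℕ → Ω → Fin K → Ξ}
  {X : Ω → EuclideanSpace ℝ (Fin D)}

omit [IsProbabilityMeasure Q] in
lemma measurable_periodEnd (hg : UnbiasedBoundedVariance L g ν σ)
    (hZ : ∀ k, IsFreshSampling Q (ν k) ℱ (fun j ω => Z j ω k)) (hℱ : Monotone ℱ)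
    (hX : Measurable[ℱ 0] X) (J : ℕ) :
    Measurable[ℱ J] (fun ω => periodEnd η w g (fun j => Z j ω) (X ω) J) := by
  have hX' : Measurable[ℱ J] X := hX.mono (hℱ J.zero_le) le_rfl
  have hS : Measurable[ℱ J] (fun ω => ∑ k,
      (sgdPath η w (g k) (fun j => Z j ω k) (X ω) J - X ω)) :=
    Finset.measurable_fun_sum _ fun k _ =>
      ((hZ k).measurable_sgdPath (hg.isStochasticField k) hX J).sub hX'
  exact hX'.add (hS.const_smul (1 / (K : ℝ)))

lemma memLp_periodEnd (hL : Smoothness L G Lstar) (hg : UnbiasedBoundedVariance L g ν σ)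
    (hZ : ∀ k, IsFreshSampling Q (ν k) ℱ (fun j ω => Z j ω k))
    (hX : Measurable[ℱ 0] X) (hX2 : MemLp X 2 Q) (J : ℕ) :
    MemLp (fun ω => periodEnd η w g (fun j => Z j ω) (X ω) J) 2 Q := by
  have hS : MemLp (fun ω => ∑ k, (sgdPath η w (g k) (fun j => Z j ω k) (X ω) J - X ω)) 2 Q :=
    memLp_finsetSum _ fun k _ =>
      ((hZ k).memLp_sgdPath (hg.isStochasticField k) (hL.lipschitz k) hX hX2 J).sub hX2
  exact hX2.add (hS.const_smul (1 / (K : ℝ)))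

/-- The expected decrease of the global objective over one period, before the drift of the clients
is estimated. -/
lemma integral_globalLoss_periodEnd_le_drift (hK : 0 < K) (hG : 0 ≤ G) (hη : 0 ≤ η)
    (hL : Smoothness L G Lstar) (hg : UnbiasedBoundedVariance L g ν σ)
    (hZ : ∀ k, IsFreshSampling Q (ν k) ℱ (fun j ω => Z j ω k))
    (hX : Measurable[ℱ 0] X) (hX2 : MemLp X 2 Q) (hw : ∀ j, 0 ≤ w j) (J : ℕ)
    (hstep : G * η * ∑ j ∈ Finset.range J, w j ≤ 1 / 2) :
    ∫ ω, globalLoss L (periodEnd η w g (fun j => Z j ω) (X ω) J) ∂Q ≤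
      ∫ ω, globalLoss L (X ω) ∂Q
        - η / 2 * (∑ j ∈ Finset.range J, w j) * ∫ ω, ‖gradient (globalLoss L) (X ω)‖ ^ 2 ∂Q
        + η / 2 * ∑ j ∈ Finset.range J, w j * ((1 / (K : ℝ)) * ∑ k,
            G ^ 2 * ∫ ω, ‖sgdPath η w (g k) (fun j => Z j ω k) (X ω) j - X ω‖ ^ 2 ∂Q)
        + G * η ^ 2 * (σ ^ 2 * ∑ j ∈ Finset.range J, w j ^ 2) := by
  set F := globalLoss L with hF
  let x : Fin K → ℕ → Ω → EuclideanSpace ℝ (Fin D) := fun k j ω =>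
    sgdPath η w (g k) (fun j => Z j ω k) (X ω) j
  let n : Fin K → ℕ → Ω → EuclideanSpace ℝ (Fin D) := fun k j ω =>
    sgdNoise (gradient (L k)) η w (g k) (fun j => Z j ω k) (X ω) j
  let A : Fin K → Ω → EuclideanSpace ℝ (Fin D) := fun k ω => ∑ j ∈ Finset.range J, w j • n k j ω
  let N : Ω → EuclideanSpace ℝ (Fin D) := fun ω => (1 / (K : ℝ)) • ∑ k, A k ω
  have hn : ∀ k j, MemLp (n k j) 2 Q := fun k j =>
    (hZ k).memLp_sgdNoise (hg.isStochasticField k) (hL.lipschitz k) hX j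
  have hA : ∀ k, MemLp (A k) 2 Q := fun k =>
    (hZ k).memLp_sum_sgdNoise (hg.isStochasticField k) (hL.lipschitz k) hX J
  have hN : MemLp N 2 Q := by
    have hS : MemLp (fun ω => ∑ k, A k ω) 2 Q := memLp_finsetSum _ fun k _ => hA k
    exact hS.const_smul (1 / (K : ℝ))
  have hFX : MemLp (fun ω => gradient F (X ω)) 2 Q :=
    hX2.comp_lipschitz (hL.norm_gradient_globalLoss_sub_le hK)
  have hx2 : ∀ k j, MemLp (fun ω => x k j ω - X ω) 2 Q := fun k j =>
    ((hZ k).memLp_sgdPath (hg.isStochasticField k) (hL.lipschitz k) hX hX2 j).sub hX2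
  have hpt : ∀ ω, F (periodEnd η w g (fun j => Z j ω) (X ω) J) ≤
      F (X ω) - η * inner ℝ (gradient F (X ω)) (N ω)
        - η / 2 * (∑ j ∈ Finset.range J, w j) * ‖gradient F (X ω)‖ ^ 2
        + η / 2 * ∑ j ∈ Finset.range J, w j *
            ((1 / (K : ℝ)) * ∑ k, G ^ 2 * ‖x k j ω - X ω‖ ^ 2)
        + G * η ^ 2 * ((1 / (K : ℝ)) * ∑ k, ‖A k ω‖ ^ 2) := fun ω => by
    rw [periodEnd_eq_sub L]
    refine (le_of_noisy_step hL.differentiable_globalLoss (hL.norm_gradient_globalLoss_sub_le hK)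
      hG hη hw J hstep _ _ _).trans ?_
    have h1 : ∀ j, ‖(1 / (K : ℝ)) • ∑ k, gradient (L k) (x k j ω) - gradient F (X ω)‖ ^ 2 ≤
        (1 / (K : ℝ)) * ∑ k, G ^ 2 * ‖x k j ω - X ω‖ ^ 2 := fun j => by
      rw [hL.gradient_globalLoss, ← smul_sub, ← Finset.sum_sub_distrib]
      refine (norm_sq_average_le hK _).trans (average_mono fun k => ?_)
      rw [← mul_pow]
      gcongr
      exact hL.lipschitz k _ _
    have h2 : ‖N ω‖ ^ 2 ≤ (1 / (K : ℝ)) * ∑ k, ‖A k ω‖ ^ 2 := norm_sq_average_le hK _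
    have h3 : ∑ j ∈ Finset.range J, w j *
        ‖(1 / (K : ℝ)) • ∑ k, gradient (L k) (x k j ω) - gradient F (X ω)‖ ^ 2 ≤
        ∑ j ∈ Finset.range J, w j * ((1 / (K : ℝ)) * ∑ k, G ^ 2 * ‖x k j ω - X ω‖ ^ 2) :=
      Finset.sum_le_sum fun j _ => mul_le_mul_of_nonneg_left (h1 j) (hw j)
    have h4 := mul_le_mul_of_nonneg_left h2 (by positivity : 0 ≤ G * η ^ 2)
    have h5 := mul_le_mul_of_nonneg_left h3 (by positivity : 0 ≤ η / 2)
    exact add_le_add (add_le_add le_rfl h5) h4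
  have hi1 : Integrable (fun ω => F (X ω)) Q := hL.integrable_globalLoss hK hG hX2
  have hi0 : Integrable (fun ω => F (periodEnd η w g (fun j => Z j ω) (X ω) J)) Q :=
    hL.integrable_globalLoss hK hG (memLp_periodEnd hL hg hZ hX hX2 J)
  have hi2 : Integrable (fun ω => η * inner ℝ (gradient F (X ω)) (N ω)) Q :=
    (hFX.integrable_inner_of_two hN).const_mul η
  have hi3 : Integrable (fun ω => η / 2 * (∑ j ∈ Finset.range J, w j) *
      ‖gradient F (X ω)‖ ^ 2) Q :=
    ((memLp_two_iff_integrable_sq_norm hFX.1).1 hFX).const_mul _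
  have hix : ∀ k j, Integrable (fun ω => G ^ 2 * ‖x k j ω - X ω‖ ^ 2) Q := fun k j =>
    ((memLp_two_iff_integrable_sq_norm (hx2 k j).1).1 (hx2 k j)).const_mul _
  have hix' : ∀ j, Integrable (fun ω => w j *
      ((1 / (K : ℝ)) * ∑ k, G ^ 2 * ‖x k j ω - X ω‖ ^ 2)) Q := fun j =>
    ((integrable_finsetSum _ fun k _ => hix k j).const_mul _).const_mul _
  have hi4 : Integrable (fun ω => η / 2 * ∑ j ∈ Finset.range J, w j *
      ((1 / (K : ℝ)) * ∑ k, G ^ 2 * ‖x k j ω - X ω‖ ^ 2)) Q :=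
    (integrable_finsetSum _ fun j _ => hix' j).const_mul _
  have hiA : ∀ k, Integrable (fun ω => ‖A k ω‖ ^ 2) Q := fun k =>
    (memLp_two_iff_integrable_sq_norm (hA k).1).1 (hA k)
  have hi5 : Integrable (fun ω => G * η ^ 2 * ((1 / (K : ℝ)) * ∑ k, ‖A k ω‖ ^ 2)) Q :=
    ((integrable_finsetSum _ fun k _ => hiA k).const_mul _).const_mul _
  have hi12 : Integrable (fun ω => F (X ω) - η * inner ℝ (gradient F (X ω)) (N ω)) Q :=
    hi1.sub hi2
  have hi123 : Integrable (fun ω => F (X ω) - η * inner ℝ (gradient F (X ω)) (N ω)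
      - η / 2 * (∑ j ∈ Finset.range J, w j) * ‖gradient F (X ω)‖ ^ 2) Q := hi12.sub hi3
  have hi1234 : Integrable (fun ω => F (X ω) - η * inner ℝ (gradient F (X ω)) (N ω)
      - η / 2 * (∑ j ∈ Finset.range J, w j) * ‖gradient F (X ω)‖ ^ 2
      + η / 2 * ∑ j ∈ Finset.range J, w j *
        ((1 / (K : ℝ)) * ∑ k, G ^ 2 * ‖x k j ω - X ω‖ ^ 2)) Q := hi123.add hi4
  have hint := integral_mono hi0 (hi1234.add hi5) hpt
  simp only [Pi.add_apply] at hint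
  rw [integral_add hi1234 hi5, integral_add hi123 hi4, integral_sub hi12 hi3, integral_sub hi1 hi2,
    integral_const_mul, integral_const_mul, integral_const_mul, integral_const_mul,
    integral_const_mul, integral_finsetSum _ fun j _ => hix' j,
    integral_finsetSum _ fun k _ => hiA k] at hint
  have hzero : ∫ ω, inner ℝ (gradient F (X ω)) (N ω) ∂Q = 0 := by
    have hterm : ∀ k j, Integrable (fun ω => w j * inner ℝ (gradient F (X ω)) (n k j ω)) Q :=
      fun k j => (hFX.integrable_inner_of_two (hn k j)).const_mul _
    have h1 : ∀ ω, inner ℝ (gradient F (X ω)) (N ω) = (1 / (K : ℝ)) * ∑ k,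
        ∑ j ∈ Finset.range J, w j * inner ℝ (gradient F (X ω)) (n k j ω) := fun ω => by
      simp only [N, A, inner_smul_right, inner_sum]
    simp only [h1]
    rw [integral_const_mul, integral_finsetSum _ fun k _ => integrable_finsetSum _ fun j _ =>
      hterm k j]
    rw [Finset.sum_eq_zero, mul_zero]
    intro k _
    rw [integral_finsetSum _ fun j _ => hterm k j]
    refine Finset.sum_eq_zero fun j _ => ?_
    have h2 : Measurable (gradient F) :=
      measurable_of_lipschitz_norm (hL.norm_gradient_globalLoss_sub_le hK)
    have h3 : ∫ ω, inner ℝ (gradient F (X ω)) (n k j ω) ∂Q = 0 :=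
      (hg.isStochasticField k).integral_inner_noise
        (measurable_of_lipschitz_norm (hL.lipschitz k)) ((hZ k).le j)
        ((hZ k).measurable_sgdPath (hg.isStochasticField k) hX j) ((hZ k).measurable_sample j)
        ((hZ k).indep j) ((hZ k).law j)
        (h2.comp (hX.mono ((hZ k).mono j.zero_le) le_rfl)) hFX
    rw [integral_const_mul, h3, mul_zero]
  have hnoise : (1 / (K : ℝ)) * ∑ k, ∫ ω, ‖A k ω‖ ^ 2 ∂Q ≤
      σ ^ 2 * ∑ j ∈ Finset.range J, w j ^ 2 := by
    refine (average_mono fun k => (hZ k).integral_norm_sq_sum_sgdNoise_le (hg.isStochasticField k)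
      (hL.lipschitz k) hX J).trans_eq ?_
    exact average_const (M := ℝ) hK _
  have hdrift : ∀ j, ∫ ω, w j * ((1 / (K : ℝ)) * ∑ k, G ^ 2 * ‖x k j ω - X ω‖ ^ 2) ∂Q =
      w j * ((1 / (K : ℝ)) * ∑ k, G ^ 2 * ∫ ω, ‖x k j ω - X ω‖ ^ 2 ∂Q) := fun j => by
    rw [integral_const_mul, integral_const_mul, integral_finsetSum _ fun k _ => hix k j]
    simp only [integral_const_mul]
  simp only [hdrift, hzero, mul_zero, sub_zero] at hint
  refine hint.trans ?_
  gcongr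

/-- The expected decrease of the global objective over one period: the drift of the clients is of
second order in the step size, up to the dissimilarity of the local objectives. -/
theorem integral_globalLoss_periodEnd_le (hK : 0 < K) (hG : 0 ≤ G) (hη : 0 ≤ η)
    (hL : Smoothness L G Lstar) (hg : UnbiasedBoundedVariance L g ν σ)
    (hd : BoundedDissimilarity L β κ)
    (hZ : ∀ k, IsFreshSampling Q (ν k) ℱ (fun j ω => Z j ω k))
    (hX : Measurable[ℱ 0] X) (hX2 : MemLp X 2 Q) (hw : ∀ j, 0 ≤ w j) (J : ℕ)
    (hstep : G * η * ∑ j ∈ Finset.range J, w j ≤ 1 / 4) :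
    ∫ ω, globalLoss L (periodEnd η w g (fun j => Z j ω) (X ω) J) ∂Q ≤
      ∫ ω, globalLoss L (X ω) ∂Q
        - η / 2 * (∑ j ∈ Finset.range J, w j) * ∫ ω, ‖gradient (globalLoss L) (X ω)‖ ^ 2 ∂Q
        + η / 2 * (∑ j ∈ Finset.range J, w j) * (G ^ 2 *
            (4 * η ^ 2 * σ ^ 2 * ∑ j ∈ Finset.range J, w j ^ 2 +
              8 * η ^ 2 * (∑ j ∈ Finset.range J, w j) ^ 2 *
                (β ^ 2 * ∫ ω, ‖gradient (globalLoss L) (X ω)‖ ^ 2 ∂Q + κ ^ 2)))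
        + G * η ^ 2 * (σ ^ 2 * ∑ j ∈ Finset.range J, w j ^ 2) := by
  set W := ∑ j ∈ Finset.range J, w j with hW
  set V := ∑ j ∈ Finset.range J, w j ^ 2 with hV
  have hW0 : 0 ≤ W := Finset.sum_nonneg fun j _ => hw j
  have hmain := integral_globalLoss_periodEnd_le_drift hK hG hη hL hg hZ hX hX2 hw J
    (hstep.trans (by norm_num))
  have hstep' : 8 * η ^ 2 * G ^ 2 * W ^ 2 ≤ 1 := by
    have h0 : 0 ≤ G * η * W := by positivity
    nlinarith
  have hkX : ∀ k, MemLp (fun ω => gradient (L k) (X ω)) 2 Q := fun k =>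
    hX2.comp_lipschitz (hL.lipschitz k)
  have hki : ∀ k, Integrable (fun ω => ‖gradient (L k) (X ω)‖ ^ 2) Q := fun k =>
    (memLp_two_iff_integrable_sq_norm (hkX k).1).1 (hkX k)
  have hFX : MemLp (fun ω => gradient (globalLoss L) (X ω)) 2 Q :=
    hX2.comp_lipschitz (hL.norm_gradient_globalLoss_sub_le hK)
  have hFi : Integrable (fun ω => ‖gradient (globalLoss L) (X ω)‖ ^ 2) Q :=
    (memLp_two_iff_integrable_sq_norm hFX.1).1 hFX
  have hdis : (1 / (K : ℝ)) * ∑ k, ∫ ω, ‖gradient (L k) (X ω)‖ ^ 2 ∂Q ≤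
      β ^ 2 * ∫ ω, ‖gradient (globalLoss L) (X ω)‖ ^ 2 ∂Q + κ ^ 2 := by
    have h1 := integral_mono ((integrable_finsetSum _ fun k _ => hki k).const_mul (1 / (K : ℝ)))
      ((hFi.const_mul (β ^ 2)).add (integrable_const (κ ^ 2))) fun ω => hd (X ω)
    simp only [Pi.add_apply] at h1
    rw [integral_const_mul, integral_finsetSum _ fun k _ => hki k,
      integral_add (hFi.const_mul (β ^ 2)) (integrable_const (κ ^ 2)), integral_const_mul] at h1
    simpa using h1
  have hdrift : ∀ j ∈ Finset.range J, (1 / (K : ℝ)) * ∑ k,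
      G ^ 2 * ∫ ω, ‖sgdPath η w (g k) (fun j => Z j ω k) (X ω) j - X ω‖ ^ 2 ∂Q ≤
      G ^ 2 * (4 * η ^ 2 * σ ^ 2 * V + 8 * η ^ 2 * W ^ 2 *
        (β ^ 2 * ∫ ω, ‖gradient (globalLoss L) (X ω)‖ ^ 2 ∂Q + κ ^ 2)) := fun j hj => by
    refine (average_mono fun k => mul_le_mul_of_nonneg_left
      ((hZ k).integral_norm_sq_sgdPath_sub_le (hg.isStochasticField k) (hL.lipschitz k) hX hX2 hw J
        hstep' j (Finset.mem_range.1 hj).le) (sq_nonneg G)).trans ?_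
    have h1 : ∀ (A B : ℝ) (u : Fin K → ℝ), (1 / (K : ℝ)) * ∑ k, G ^ 2 * (A + B * u k) =
        G ^ 2 * (A + B * ((1 / (K : ℝ)) * ∑ k, u k)) := fun A B u => by
      have h2 : (1 / (K : ℝ)) * ∑ _k : Fin K, A = A := average_const (M := ℝ) hK A
      rw [← Finset.mul_sum, Finset.sum_add_distrib, ← Finset.mul_sum, mul_left_comm, mul_add, h2,
        mul_left_comm (1 / (K : ℝ))]
    rw [h1]
    gcongr
  have hsum := Finset.sum_le_sum fun j hj => mul_le_mul_of_nonneg_left (hdrift j hj) (hw j)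
  rw [← Finset.sum_mul] at hsum
  have hsum' := mul_le_mul_of_nonneg_left hsum (by positivity : 0 ≤ η / 2)
  linarith

end Period

/-! ### Recovery times -/

section RecoveryTimes

variable {s : ℕ → Bool}

lemma successTime_strictMono (hs : {r | s r = true}.Infinite) : StrictMono (successTime s) := by
  refine strictMono_nat_of_lt_succ fun t => ?_
  cases t with
  | zero => simp [successTime]
  | succ t => simpa [successTime] using Nat.nth_strictMono hs t.lt_add_one

/-- The rounds of one recovery period: failures only, up to a last successful round. -/
lemma exists_period (hs : {r | s r = true}.Infinite) (t : ℕ) :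
    ∃ m, successTime s (t + 1) = successTime s t + m + 1 ∧
      (∀ i < m, s (successTime s t + i) = false) ∧ s (successTime s t + m) = true := by
  obtain ⟨m, hm⟩ := Nat.exists_eq_add_of_lt (successTime_strictMono hs t.lt_add_one)
  have hnth : Nat.nth (fun r => s r = true) t = successTime s t + m := by
    simp only [successTime] at hm ⊢
    omega
  refine ⟨m, hm, fun i hi => ?_, hnth ▸ Nat.nth_mem_of_infinite hs t⟩
  by_contra hne
  have hi' : s (successTime s t + i) = true := by simpa using hne
  have h1 := Nat.nth_count (p := fun r => s r = true) hi'
  set c := Nat.count (fun r => s r = true) (successTime s t + i)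
  have hct : c < t := by
    rw [← Nat.nth_lt_nth hs, h1, hnth]
    omega
  obtain ⟨u, rfl⟩ : ∃ u, t = u + 1 := ⟨t - 1, by omega⟩
  have h2 : Nat.nth (fun r => s r = true) c ≤ Nat.nth (fun r => s r = true) u :=
    Nat.nth_monotone hs (by omega)
  simp only [successTime] at h1
  omega

lemma roundsBetween_succ_add (hs : {r | s r = true}.Infinite) (t : ℕ) :
    successTime s t + roundsBetween s (t + 1) = successTime s (t + 1) := by
  have := successTime_strictMono hs t.lt_add_one
  simp only [roundsBetween, Nat.add_sub_cancel]
  omega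

lemma one_le_roundsBetween (hs : {r | s r = true}.Infinite) (t : ℕ) :
    1 ≤ roundsBetween s (t + 1) := by
  have := successTime_strictMono hs t.lt_add_one
  have := roundsBetween_succ_add hs t
  omega

lemma sum_roundsBetween (hs : {r | s r = true}.Infinite) (n : ℕ) :
    ∑ t ∈ Finset.range n, roundsBetween s (t + 1) = successTime s n := by
  induction n with
  | zero => rfl
  | succ n ih => rw [Finset.sum_range_succ, ih, roundsBetween_succ_add hs]

lemma sum_Icc_one_eq_sum_range {M : Type*} [AddCommMonoid M] (f : ℕ → M) (n : ℕ) :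
    ∑ t ∈ Finset.Icc 1 n, f t = ∑ t ∈ Finset.range n, f (t + 1) := by
  rw [Finset.range_eq_Ico, Finset.sum_Ico_add' f 0 n 1]
  rfl

lemma numUpdates_eq (hs : {r | s r = true}.Infinite) (T : ℕ) :
    numUpdates s T = sInf {n | T ≤ successTime s n} := by
  simp only [numUpdates, sum_Icc_one_eq_sum_range, sum_roundsBetween hs]

lemma le_successTime_numUpdates (hs : {r | s r = true}.Infinite) (T : ℕ) :
    T ≤ successTime s (numUpdates s T) := by
  rw [numUpdates_eq hs]
  exact Nat.sInf_mem (s := {n | T ≤ successTime s n}) ⟨T, (successTime_strictMono hs).le_apply⟩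

lemma successTime_lt_of_lt_numUpdates (hs : {r | s r = true}.Infinite) {T t : ℕ}
    (ht : t < numUpdates s T) : successTime s t < T := by
  rw [numUpdates_eq hs] at ht
  exact not_le.1 (Nat.notMem_of_lt_sInf (s := {n | T ≤ successTime s n}) ht)

/-- Every success among the first `T` rounds is counted by `numUpdates s T`. -/
lemma count_le_numUpdates (hs : {r | s r = true}.Infinite) (T : ℕ) :
    Nat.count (fun r => s r = true) T ≤ numUpdates s T := by
  have h := le_successTime_numUpdates hs T
  cases hn : numUpdates s T with
  | zero =>
    rw [hn] at h
    have : T = 0 := Nat.le_zero.1 h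
    simp [this]
  | succ n =>
    rw [hn] at h
    calc Nat.count (fun r => s r = true) T
        ≤ Nat.count (fun r => s r = true) (Nat.nth (fun r => s r = true) n + 1) :=
          Nat.count_monotone _ h
      _ = n + 1 := Nat.count_nth_succ_of_infinite hs n

/-- If no `M` consecutive rounds starting before `T` all fail, the periods up to the last counted
update have at most `M` rounds. -/
lemma roundsBetween_le_of_no_run (hs : {r | s r = true}.Infinite) {T M : ℕ}
    (hM : ∀ r < T, ∃ i < M, s (r + i) = true) {t : ℕ} (ht : t < numUpdates s T) :
    roundsBetween s (t + 1) ≤ M := by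
  obtain ⟨m, hm, hfail, -⟩ := exists_period hs t
  obtain ⟨i, hi, hsi⟩ := hM _ (successTime_lt_of_lt_numUpdates hs ht)
  have hmi : m ≤ i := by
    by_contra hlt
    simp [hfail i (not_le.1 hlt)] at hsi
  have := roundsBetween_succ_add hs t
  omega

end RecoveryTimes

/-! ### The rounds as one sequence of iterations -/

section Flat

variable {K D I : ℕ} {Ξ : Type*}

/-- The mini-batches in the order of their use: iteration `i` of round `r` has index `r * I + i`. -/
def flatSample (hI : 0 < I) (z : ℕ → Fin I → Fin K → Ξ) (n : ℕ) : Fin K → Ξ :=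
  z (n / I) ⟨n % I, Nat.mod_lt n hI⟩

/-- The weights of the local solver repeated periodically. -/
def flatWeight (hI : 0 < I) (a : Fin I → ℝ) (n : ℕ) : ℝ := a ⟨n % I, Nat.mod_lt n hI⟩

lemma flatSample_mul_add (hI : 0 < I) (z : ℕ → Fin I → Fin K → Ξ) (r : ℕ) (i : Fin I) :
    flatSample hI z (r * I + i) = z r i := by
  have h1 : (r * I + i) / I = r := by
    rw [mul_comm, Nat.mul_add_div hI, Nat.div_eq_of_lt i.2, add_zero]
  have h2 : (r * I + i) % I = i := by
    rw [mul_comm, Nat.mul_add_mod, Nat.mod_eq_of_lt i.2]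
  simp only [flatSample, h1, h2, Fin.eta]

lemma flatWeight_mul_add (hI : 0 < I) (a : Fin I → ℝ) (r : ℕ) (i : Fin I) :
    flatWeight hI a (r * I + i) = a i := by
  have h2 : (r * I + i) % I = i := by
    rw [mul_comm, Nat.mul_add_mod, Nat.mod_eq_of_lt i.2]
  simp only [flatWeight, h2, Fin.eta]

lemma sum_flatWeight (hI : 0 < I) (a : Fin I → ℝ) (f : ℝ → ℝ) (R : ℕ) :
    ∑ j ∈ Finset.range (R * I), f (flatWeight hI a j) = R * ∑ i, f (a i) := by
  induction R with
  | zero => simp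
  | succ R ih =>
    rw [Nat.succ_mul, Finset.sum_range_add, ih, Finset.sum_range]
    simp only [flatWeight_mul_add]
    push_cast
    ring

lemma foldl_eq_of_step {α : Type*} : ∀ (n : ℕ) (f : α → Fin n → α) (u : ℕ → α),
    (∀ i : Fin n, u (i + 1) = f (u i) i) → Fin.foldl n f (u 0) = u n
  | 0, _, _, _ => by simp
  | n + 1, f, u, h => by
    rw [Fin.foldl_succ_last, foldl_eq_of_step n (fun x i => f x i.castSucc) u
      fun i => h i.castSucc]
    exact (h (Fin.last n)).symm

lemma localTraining_sgdPath (hI : 0 < I) (η : ℝ) (a : Fin I → ℝ)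
    (g : Fin K → EuclideanSpace ℝ (Fin D) → Ξ → EuclideanSpace ℝ (Fin D))
    (z : ℕ → Fin I → Fin K → Ξ) (x : EuclideanSpace ℝ (Fin D)) (q m : ℕ) (k : Fin K) :
    localTraining η a (g k) (fun i => z (q + m) i k)
        (sgdPath η (flatWeight hI a) (g k) (fun j => flatSample hI z (q * I + j) k) x (m * I)) =
      sgdPath η (flatWeight hI a) (g k) (fun j => flatSample hI z (q * I + j) k) x
        ((m + 1) * I) := by
  have h := foldl_eq_of_step I (fun y i => y - (η * a i) • g k y (z (q + m) i k))
    (fun i => sgdPath η (flatWeight hI a) (g k) (fun j => flatSample hI z (q * I + j) k) x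
      (m * I + i)) fun i => by
    have h1 : q * I + (m * I + i) = (q + m) * I + i := by ring
    rw [← add_assoc, sgdPath, flatWeight_mul_add, h1, flatSample_mul_add]
  rw [Nat.succ_mul]
  exact h

variable {η : ℝ} {a : Fin I → ℝ}
  {g : Fin K → EuclideanSpace ℝ (Fin D) → Ξ → EuclideanSpace ℝ (Fin D)}
  {Θ₀ : EuclideanSpace ℝ (Fin D)} {s : ℕ → Bool} {z : ℕ → Fin I → Fin K → Ξ}

lemma systemState_of_failures (hI : 0 < I) {q : ℕ} {x : EuclideanSpace ℝ (Fin D)}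
    (hq : systemState η a g Θ₀ s z q = ⟨x, fun _ => x⟩) (m : ℕ)
    (hm : ∀ i < m, s (q + i) = false) :
    systemState η a g Θ₀ s z (q + m) = ⟨x, fun k =>
      sgdPath η (flatWeight hI a) (g k) (fun j => flatSample hI z (q * I + j) k) x (m * I)⟩ := by
  induction m with
  | zero => simpa [sgdPath] using hq
  | succ m ih =>
    have ih' := ih fun i hi => hm i (hi.trans m.lt_succ_self)
    rw [← add_assoc, systemState, ih']
    simp only [hm m m.lt_succ_self, localTraining_sgdPath]
    rfl

lemma systemState_of_success (hI : 0 < I) {q : ℕ} {x : EuclideanSpace ℝ (Fin D)}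
    (hq : systemState η a g Θ₀ s z q = ⟨x, fun _ => x⟩) (m : ℕ)
    (hm : ∀ i < m, s (q + i) = false) (hs : s (q + m) = true) :
    systemState η a g Θ₀ s z (q + m + 1) =
      ⟨periodEnd η (flatWeight hI a) g (fun j => flatSample hI z (q * I + j)) x ((m + 1) * I),
        fun _ => periodEnd η (flatWeight hI a) g (fun j => flatSample hI z (q * I + j)) x
          ((m + 1) * I)⟩ := by
  rw [systemState, systemState_of_failures hI hq m hm]
  simp only [hs, localTraining_sgdPath, if_true]
  rfl

lemma systemState_successTime (hI : 0 < I) (hs : {r | s r = true}.Infinite) (t : ℕ) :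
    systemState η a g Θ₀ s z (successTime s t) =
      ⟨globalModel η a g Θ₀ s z t, fun _ => globalModel η a g Θ₀ s z t⟩ := by
  induction t with
  | zero => rfl
  | succ t ih =>
    obtain ⟨m, hm, hfail, hsucc⟩ := exists_period hs t
    have h := systemState_of_success hI ih m hfail hsucc
    simp only [globalModel]
    rw [hm, h]

/-- From one recovered global model to the next. -/
lemma globalModel_succ (hI : 0 < I) (hs : {r | s r = true}.Infinite) (t : ℕ) :
    globalModel η a g Θ₀ s z (t + 1) =
      periodEnd η (flatWeight hI a) g (fun j => flatSample hI z (successTime s t * I + j))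
        (globalModel η a g Θ₀ s z t) (roundsBetween s (t + 1) * I) := by
  obtain ⟨m, hm, hfail, hsucc⟩ := exists_period hs t
  have h := systemState_of_success hI (systemState_successTime (η := η) (a := a) (g := g)
    (Θ₀ := Θ₀) (z := z) hI hs t) m hfail hsucc
  have hR : roundsBetween s (t + 1) = m + 1 := by
    have := roundsBetween_succ_add hs t
    omega
  rw [hR]
  conv_lhs => rw [globalModel, hm, h]

variable {Ω : Type*} [MeasurableSpace Ξ] [mΩ : MeasurableSpace Ω] {Q : Measure Ω}
  {ν : Fin K → Measure Ξ} {ξ : ℕ → Fin I → Fin K → Ω → Ξ}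

/-- The information contained in the mini-batches of the first `n` iterations. -/
@[reducible] def sampleHistory (hI : 0 < I) (ξ : ℕ → Fin I → Fin K → Ω → Ξ) (n : ℕ) :
    MeasurableSpace Ω :=
  ⨆ m ∈ Set.Iio n,
    MeasurableSpace.comap (fun ω => flatSample hI (fun r i k => ξ r i k ω) m) inferInstance

omit mΩ in
lemma sampleHistory_mono (hI : 0 < I) (ξ : ℕ → Fin I → Fin K → Ω → Ξ) :
    Monotone (sampleHistory hI ξ) := fun _ _ h =>
  biSup_mono fun _ hm => lt_of_lt_of_le hm h

lemma IsMiniBatchSampling.measurable_flatSample (hξ : IsMiniBatchSampling Q ν ξ) (hI : 0 < I)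
    (n : ℕ) : Measurable (fun ω => flatSample hI (fun r i k => ξ r i k ω) n) :=
  measurable_pi_lambda _ fun _ => hξ.measurable _ _ _

lemma IsMiniBatchSampling.isFreshSampling (hξ : IsMiniBatchSampling Q ν ξ) (hI : 0 < I)
    (n : ℕ) (k : Fin K) :
    IsFreshSampling Q (ν k) (fun j => sampleHistory hI ξ (n + j))
      (fun j ω => flatSample hI (fun r i k => ξ r i k ω) (n + j) k) where
  le j := iSup₂_le fun m _ => (hξ.measurable_flatSample hI m).comap_le
  mono := fun _ _ h => sampleHistory_mono hI ξ (Nat.add_le_add_left h n)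
  measurable j := by
    have h1 : MeasurableSpace.comap
        (fun ω => flatSample hI (fun r i k => ξ r i k ω) (n + j)) inferInstance ≤
        sampleHistory hI ξ (n + (j + 1)) :=
      le_biSup (fun m => MeasurableSpace.comap
        (fun ω => flatSample hI (fun r i k => ξ r i k ω) m) inferInstance)
        (show n + j ∈ Set.Iio (n + (j + 1)) by simp [← add_assoc])
    exact (measurable_pi_apply k).comp (measurable_iff_comap_le.2 h1)
  indep j := by
    have hinj : Function.Injective
        (fun m : ℕ => ((m / I, ⟨m % I, Nat.mod_lt m hI⟩) : ℕ × Fin I)) := fun m m' h => by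
      simp only [Prod.mk.injEq, Fin.mk.injEq] at h
      rw [← Nat.div_add_mod m I, ← Nat.div_add_mod m' I, h.1, h.2]
    have hind : iIndepFun
        (fun (m : ℕ) (ω : Ω) => flatSample hI (fun r i k => ξ r i k ω) m) Q :=
      hξ.indep.precomp hinj
    have h1 := indep_iSup_of_disjoint (fun m => (hξ.measurable_flatSample hI m).comap_le) hind
      (S := Set.Iio (n + j)) (T := {n + j}) (by simp)
    refine indep_of_indep_of_le_right h1 ?_
    simp only [Set.mem_singleton_iff, iSup_iSup_eq_left]
    exact ((measurable_pi_apply k).comp (comap_measurable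
      (fun ω => flatSample hI (fun r i k => ξ r i k ω) (n + j)))).comap_le
  law j := hξ.law _ _ k

end Flat

/-! ### Convergence for given recovery outcomes -/

section Convergence

variable {K D I : ℕ} {L : Fin K → EuclideanSpace ℝ (Fin D) → ℝ} {G Lstar σ β κ η : ℝ}
  {Ξ Ω : Type*} [MeasurableSpace Ξ] [mΩ : MeasurableSpace Ω] {Q : Measure Ω}
  [IsProbabilityMeasure Q] {ν : Fin K → Measure Ξ}
  {g : Fin K → EuclideanSpace ℝ (Fin D) → Ξ → EuclideanSpace ℝ (Fin D)}
  {ξ : ℕ → Fin I → Fin K → Ω → Ξ} {a : Fin I → ℝ} {s : ℕ → Bool}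

lemma measurable_memLp_globalModel (hI : 0 < I) (hL : Smoothness L G Lstar)
    (hg : UnbiasedBoundedVariance L g ν σ) (hξ : IsMiniBatchSampling Q ν ξ)
    (Θ₀ : EuclideanSpace ℝ (Fin D)) (hs : {r | s r = true}.Infinite) (t : ℕ) :
    Measurable[sampleHistory hI ξ (successTime s t * I)]
        (fun ω => globalModel η a g Θ₀ s (fun r i k => ξ r i k ω) t) ∧
      MemLp (fun ω => globalModel η a g Θ₀ s (fun r i k => ξ r i k ω) t) 2 Q := by
  induction t with
  | zero => exact ⟨measurable_const, memLp_const _⟩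
  | succ t ih =>
    have hZ := hξ.isFreshSampling hI (successTime s t * I)
    have hm : Monotone fun j => sampleHistory hI ξ (successTime s t * I + j) :=
      fun _ _ h => sampleHistory_mono hI ξ (Nat.add_le_add_left h _)
    have hX : Measurable[sampleHistory hI ξ (successTime s t * I + 0)]
        (fun ω => globalModel η a g Θ₀ s (fun r i k => ξ r i k ω) t) := ih.1
    simp only [globalModel_succ hI hs]
    constructor
    · have h := measurable_periodEnd (η := η) (w := flatWeight hI a) hg hZ hm hX
        (roundsBetween s (t + 1) * I)
      rwa [← add_mul, roundsBetween_succ_add hs] at h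
    · exact memLp_periodEnd hL hg hZ hX ih.2 _

lemma integrable_sqGradNorm (hI : 0 < I) (hK : 0 < K) (hL : Smoothness L G Lstar)
    (hg : UnbiasedBoundedVariance L g ν σ) (hξ : IsMiniBatchSampling Q ν ξ)
    (Θ₀ : EuclideanSpace ℝ (Fin D)) (hs : {r | s r = true}.Infinite) (t : ℕ) :
    Integrable (fun ω => sqGradNorm L η a g Θ₀ s (fun r i k => ξ r i k ω) t) Q := by
  have h := (measurable_memLp_globalModel (η := η) (a := a) hI hL hg hξ Θ₀ hs t).2.comp_lipschitz
    (hL.norm_gradient_globalLoss_sub_le hK)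
  exact (memLp_two_iff_integrable_sq_norm h.1).1 h

/-- One period, in units of `η ‖a‖₁ / 2`. If the period has at most `M` rounds and
`G η ‖a‖₁ M ^ 2 ≤ δ`, the drift contributes only relative errors of order `δ`. -/
lemma rounds_mul_integral_sqGradNorm_le (hI : 0 < I) (hK : 0 < K) (hG : 0 < G) (hη : 0 < η)
    (ha : ∀ i, 0 ≤ a i) (hA : 0 < l1Norm a) (hL : Smoothness L G Lstar)
    (hg : UnbiasedBoundedVariance L g ν σ) (hd : BoundedDissimilarity L β κ)
    (hξ : IsMiniBatchSampling Q ν ξ) (Θ₀ : EuclideanSpace ℝ (Fin D))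
    (hs : {r | s r = true}.Infinite) {M δ : ℝ} (hδ : δ ≤ 1 / 4)
    (hM : G * η * l1Norm a * M ^ 2 ≤ δ) (t : ℕ) (hRM : (roundsBetween s (t + 1) : ℝ) ≤ M) :
    (1 - 8 * δ * β ^ 2) * ((roundsBetween s (t + 1) : ℝ) *
        ∫ ω, sqGradNorm L η a g Θ₀ s (fun r i k => ξ r i k ω) t ∂Q) ≤
      2 / (η * l1Norm a) *
        (∫ ω, globalLoss L (globalModel η a g Θ₀ s (fun r i k => ξ r i k ω) t) ∂Q -
          ∫ ω, globalLoss L (globalModel η a g Θ₀ s (fun r i k => ξ r i k ω) (t + 1)) ∂Q) +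
      2 * (G * η * l1Norm a) * (1 + 2 * δ) * (σ ^ 2 + 2 * κ ^ 2) *
        (roundsBetween s (t + 1) : ℝ) := by
  set A := l1Norm a with hAdef
  set R : ℝ := (roundsBetween s (t + 1) : ℝ) with hR
  set u := G * η * A with hu
  have hu0 : 0 < u := by positivity
  have hR1 : 1 ≤ R := by
    rw [hR]
    exact_mod_cast one_le_roundsBetween hs t
  have hR0 : 0 < R := by linarith
  have hM1 : 1 ≤ M := hR1.trans hRM
  have hX := measurable_memLp_globalModel (η := η) (a := a) hI hL hg hξ Θ₀ hs t
  have hZ := hξ.isFreshSampling hI (successTime s t * I)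
  have hw : ∀ j, 0 ≤ flatWeight hI a j := fun j => ha _
  have hW : ∑ j ∈ Finset.range (roundsBetween s (t + 1) * I), flatWeight hI a j = R * A := by
    have h := sum_flatWeight hI a (fun x => x) (roundsBetween s (t + 1))
    rw [h, hR, hAdef, l1Norm]
    congr 1
    exact Finset.sum_congr rfl fun i _ => (abs_of_nonneg (ha i)).symm
  have hV : ∑ j ∈ Finset.range (roundsBetween s (t + 1) * I), flatWeight hI a j ^ 2 ≤
      R * A ^ 2 := by
    have h := sum_flatWeight hI a (fun x => x ^ 2) (roundsBetween s (t + 1))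
    rw [h, hAdef, l1Norm]
    gcongr
    refine (Finset.sum_le_sum fun i _ => le_of_eq (sq_abs (a i)).symm).trans ?_
    exact Finset.sum_sq_le_sq_sum_of_nonneg fun i _ => abs_nonneg _
  have hV0 : 0 ≤ ∑ j ∈ Finset.range (roundsBetween s (t + 1) * I), flatWeight hI a j ^ 2 :=
    Finset.sum_nonneg fun j _ => sq_nonneg _
  have huR : u * R ≤ δ := by
    calc u * R ≤ u * M ^ 2 := by gcongr; nlinarith
      _ ≤ δ := hM
  have huR2 : u * R ^ 2 ≤ δ := by
    calc u * R ^ 2 ≤ u * M ^ 2 := by gcongr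
      _ ≤ δ := hM
  have hstep : G * η * ∑ j ∈ Finset.range (roundsBetween s (t + 1) * I), flatWeight hI a j ≤
      1 / 4 := by
    rw [hW]
    calc G * η * (R * A) = u * R := by rw [hu]; ring
      _ ≤ 1 / 4 := huR.trans hδ
  have hmain := integral_globalLoss_periodEnd_le (β := β) (κ := κ)
    (X := fun ω => globalModel η a g Θ₀ s (fun r i k => ξ r i k ω) t) hK hG.le hη.le hL hg hd hZ
    hX.1 hX.2 hw (roundsBetween s (t + 1) * I) hstep
  simp only [← globalModel_succ hI hs] at hmain
  rw [hW] at hmain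
  have hH : ∫ ω, ‖gradient (globalLoss L)
      (globalModel η a g Θ₀ s (fun r i k => ξ r i k ω) t)‖ ^ 2 ∂Q =
      ∫ ω, sqGradNorm L η a g Θ₀ s (fun r i k => ξ r i k ω) t ∂Q := rfl
  rw [hH] at hmain
  set H := ∫ ω, sqGradNorm L η a g Θ₀ s (fun r i k => ξ r i k ω) t ∂Q with hHdef
  set E0 := ∫ ω, globalLoss L (globalModel η a g Θ₀ s (fun r i k => ξ r i k ω) t) ∂Q
  set E1 := ∫ ω, globalLoss L (globalModel η a g Θ₀ s (fun r i k => ξ r i k ω) (t + 1)) ∂Q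
  set V := ∑ j ∈ Finset.range (roundsBetween s (t + 1) * I), flatWeight hI a j ^ 2
  have hH0 : 0 ≤ H := integral_nonneg fun ω => sq_nonneg _
  have h1 : E1 ≤ E0 - η / 2 * (R * A) * H + η / 2 * (R * A) * (G ^ 2 *
      (4 * η ^ 2 * σ ^ 2 * (R * A ^ 2) + 8 * η ^ 2 * (R * A) ^ 2 * (β ^ 2 * H + κ ^ 2))) +
      G * η ^ 2 * (σ ^ 2 * (R * A ^ 2)) := by
    refine hmain.trans ?_
    gcongr
  have hηA : 0 < η * A := by positivity
  -- dividing by `η A / 2`, every occurrence of the step size is grouped into `u = G η A`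
  have h2 : R * H ≤ 2 / (η * A) * (E0 - E1) + R * (4 * (u * (u * R)) * σ ^ 2 +
      8 * (u * (u * R ^ 2)) * (β ^ 2 * H + κ ^ 2)) + 2 * u * R * σ ^ 2 := by
    have h3 : 2 / (η * A) * (η / 2 * (R * A) * H) ≤ 2 / (η * A) * (E0 - E1 +
      η / 2 * (R * A) * (G ^ 2 *
      (4 * η ^ 2 * σ ^ 2 * (R * A ^ 2) + 8 * η ^ 2 * (R * A) ^ 2 * (β ^ 2 * H + κ ^ 2))) +
      G * η ^ 2 * (σ ^ 2 * (R * A ^ 2))) := by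
      gcongr
      linarith
    have h4 : 2 / (η * A) * (η / 2 * (R * A) * H) = R * H := by
      field_simp
    have h5 : 2 / (η * A) * (E0 - E1 +
      η / 2 * (R * A) * (G ^ 2 *
      (4 * η ^ 2 * σ ^ 2 * (R * A ^ 2) + 8 * η ^ 2 * (R * A) ^ 2 * (β ^ 2 * H + κ ^ 2))) +
      G * η ^ 2 * (σ ^ 2 * (R * A ^ 2))) = 2 / (η * A) * (E0 - E1) +
      R * (4 * (u * (u * R)) * σ ^ 2 +
      8 * (u * (u * R ^ 2)) * (β ^ 2 * H + κ ^ 2)) + 2 * u * R * σ ^ 2 := by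
      rw [hu]
      field_simp
    rwa [h4, h5] at h3
  have hδ0 : 0 ≤ δ := (by positivity : 0 ≤ u * R).trans huR
  -- in the gradient term one factor `u` is dropped; in the noise terms it has to be kept, since
  -- they are compared with `u σ ^ 2` and `u κ ^ 2`
  have hu1 : u ≤ 1 := by
    have : u * 1 ≤ u * R := by gcongr
    linarith
  have h6 : 4 * (u * (u * R)) * σ ^ 2 ≤ 4 * (u * δ) * σ ^ 2 := by gcongr
  have h7 : 8 * (u * (u * R ^ 2)) * (β ^ 2 * H + κ ^ 2) ≤ 8 * (1 * δ) * (β ^ 2 * H) +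
      8 * (u * δ) * κ ^ 2 := by
    rw [mul_add]
    gcongr
  have h8 := mul_le_mul_of_nonneg_left (add_le_add h6 h7) hR0.le
  have h9 : R * (u * (8 * δ * κ ^ 2)) ≤ R * (u * (4 * (1 + 2 * δ) * κ ^ 2)) := by
    have h10 : 8 * δ ≤ 4 * (1 + 2 * δ) := by linarith
    exact mul_le_mul_of_nonneg_left (mul_le_mul_of_nonneg_left
      (mul_le_mul_of_nonneg_right h10 (sq_nonneg κ)) hu0.le) hR0.le
  linarith

/-- The mean squared gradients along the recovered models, weighted by the lengths of the periods:
the one-period estimates telescope. -/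
theorem sum_rounds_mul_integral_sqGradNorm_le (hI : 0 < I) (hK : 0 < K) (hG : 0 < G) (hη : 0 < η)
    (ha : ∀ i, 0 ≤ a i) (hA : 0 < l1Norm a) (hL : Smoothness L G Lstar)
    (hg : UnbiasedBoundedVariance L g ν σ) (hd : BoundedDissimilarity L β κ)
    (hξ : IsMiniBatchSampling Q ν ξ) (Θ₀ : EuclideanSpace ℝ (Fin D))
    (hs : {r | s r = true}.Infinite) {M δ : ℝ} (hδ : δ ≤ 1 / 4)
    (hM : G * η * l1Norm a * M ^ 2 ≤ δ) (n : ℕ)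
    (hRM : ∀ t < n, (roundsBetween s (t + 1) : ℝ) ≤ M) :
    (1 - 8 * δ * β ^ 2) * ∑ t ∈ Finset.range n, (roundsBetween s (t + 1) : ℝ) *
        ∫ ω, sqGradNorm L η a g Θ₀ s (fun r i k => ξ r i k ω) t ∂Q ≤
      2 / (η * l1Norm a) * (globalLoss L Θ₀ - Lstar) +
      2 * (G * η * l1Norm a) * (1 + 2 * δ) * (σ ^ 2 + 2 * κ ^ 2) * (successTime s n : ℝ) := by
  let e : ℕ → ℝ := fun t =>
    ∫ ω, globalLoss L (globalModel η a g Θ₀ s (fun r i k => ξ r i k ω) t) ∂Q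
  have hsum := Finset.sum_le_sum fun t (ht : t ∈ Finset.range n) =>
    rounds_mul_integral_sqGradNorm_le (β := β) (κ := κ) hI hK hG hη ha hA hL hg hd hξ Θ₀ hs hδ hM t
      (hRM t (Finset.mem_range.1 ht))
  rw [← Finset.mul_sum, Finset.sum_add_distrib, ← Finset.mul_sum, ← Finset.mul_sum,
    Finset.sum_range_sub' e] at hsum
  have hcast : ∑ t ∈ Finset.range n, (roundsBetween s (t + 1) : ℝ) = successTime s n := by
    rw [← sum_roundsBetween hs]
    push_cast
    rfl
  rw [hcast] at hsum
  have he0 : e 0 = globalLoss L Θ₀ := by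
    simp [e, globalModel, successTime, systemState]
  have hen : Lstar ≤ e n := by
    have h1 : ∫ _ω : Ω, Lstar ∂Q ≤ e n := integral_mono (integrable_const _)
      (hL.integrable_globalLoss hK hG.le
        (measurable_memLp_globalModel (η := η) (a := a) hI hL hg hξ Θ₀ hs n).2)
      fun ω => hL.le_globalLoss hK _
    simpa using h1
  have h2 : 2 / (η * l1Norm a) * (e 0 - e n) ≤ 2 / (η * l1Norm a) * (globalLoss L Θ₀ - Lstar) := by
    rw [he0]
    gcongr
  linarith

end Convergence

/-! ### Typical recovery outcomes -/

section Recovery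

variable {Ω : Type*} [MeasurableSpace Ω] {P : Measure Ω} [IsProbabilityMeasure P]
  {S : ℕ → Ω → Bool} {p : ℝ}

omit [IsProbabilityMeasure P] in
lemma IsBinaryRecovery.measurableSet_eq (hS : IsBinaryRecovery P S p) (r : ℕ) (b : Bool) :
    MeasurableSet {ω | S r ω = b} := hS.measurable r (measurableSet_singleton b)

lemma IsBinaryRecovery.prob_failure (hS : IsBinaryRecovery P S p) (r : ℕ) :
    P.real {ω | S r ω = false} = p := by
  have h : {ω | S r ω = false} = {ω | S r ω = true}ᶜ := by
    ext ω
    simp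
  rw [h, probReal_compl_eq_one_sub (hS.measurableSet_eq r true), hS.prob_success]
  ring

lemma IsBinaryRecovery.prob_run (hS : IsBinaryRecovery P S p) (r M : ℕ) :
    P.real {ω | ∀ i < M, S (r + i) ω = false} = p ^ M := by
  have h : {ω | ∀ i < M, S (r + i) ω = false} =
      ⋂ i ∈ Finset.range M, {ω | S (r + i) ω = false} := by
    ext ω
    simp
  have hind : iIndepFun (fun i => S (r + i)) P :=
    hS.indep.precomp (g := fun i => r + i) fun _ _ h => Nat.add_left_cancel h
  have h1 := hind.meas_biInter (S := Finset.range M) (s := fun i => {ω | S (r + i) ω = false})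
    fun i _ => ⟨{false}, measurableSet_singleton _, rfl⟩
  rw [h, measureReal_def, h1, ENNReal.toReal_prod]
  have h2 : ∀ i, (P {ω | S (r + i) ω = false}).toReal = p := fun i => hS.prob_failure _
  simp [h2]

lemma IsBinaryRecovery.prob_exists_run_le (hS : IsBinaryRecovery P S p) (T M : ℕ) :
    P.real {ω | ∃ r < T, ∀ i < M, S (r + i) ω = false} ≤ T * p ^ M := by
  have h : {ω | ∃ r < T, ∀ i < M, S (r + i) ω = false} =
      ⋃ r ∈ Finset.range T, {ω | ∀ i < M, S (r + i) ω = false} := by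
    ext ω
    simp
  rw [h]
  refine (measureReal_biUnion_finset_le _ _).trans ?_
  simp [hS.prob_run]

lemma IsBinaryRecovery.ae_infinite (hS : IsBinaryRecovery P S p) (hp0 : 0 ≤ p) (hp : p < 1) :
    ∀ᵐ ω ∂P, {r | S r ω = true}.Infinite := by
  have h : ∀ r, ∀ᵐ ω ∂P, ∃ i, S (r + i) ω = true := fun r => by
    rw [ae_iff]
    have h1 : ∀ M : ℕ, P.real {ω | ¬∃ i, S (r + i) ω = true} ≤ p ^ M := fun M => by
      rw [← hS.prob_run r M]
      refine measureReal_mono fun ω hω i _ => ?_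
      simp only [Set.mem_ofPred_eq, not_exists] at hω
      simpa using hω i
    have h2 := ge_of_tendsto' (tendsto_pow_atTop_nhds_zero_of_lt_one hp0 hp) h1
    exact (measureReal_eq_zero_iff).1 (le_antisymm h2 measureReal_nonneg)
  filter_upwards [ae_all_iff.2 h] with ω hω
  refine Set.infinite_of_not_bddAbove fun ⟨B, hB⟩ => ?_
  obtain ⟨i, hi⟩ := hω (B + 1)
  have := hB hi
  omega

/-- Chebyshev's inequality for the number of successes among the first `T` rounds. -/
lemma IsBinaryRecovery.prob_count_lt_le (hS : IsBinaryRecovery P S p) {T : ℕ} (hT : 0 < T)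
    {c : ℝ} (hc : 0 < c) :
    P.real {ω | (Nat.count (fun r => S r ω = true) T : ℝ) < T * (1 - p) - T * c} ≤
      1 / (T * c ^ 2) := by
  have hT' : (0 : ℝ) < T := by exact_mod_cast hT
  let φ : Bool → ℝ := fun b => if b = true then 1 else 0
  have hφ : Measurable φ := measurable_of_finite φ
  let X : ℕ → Ω → ℝ := fun r => φ ∘ S r
  have hXm : ∀ r, Measurable (X r) := fun r => hφ.comp (hS.measurable r)
  have hX01 : ∀ r ω, X r ω ∈ Set.Icc (0 : ℝ) 1 := fun r ω => by
    simp only [X, φ, Function.comp_apply]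
    split_ifs <;> simp
  have hX2 : ∀ r, MemLp (X r) 2 P := fun r =>
    MemLp.of_bound (hXm r).aestronglyMeasurable 1 (.of_forall fun ω => by
      rw [Real.norm_eq_abs, abs_of_nonneg (hX01 r ω).1]
      exact (hX01 r ω).2)
  have hmean : ∀ r, ∫ ω, X r ω ∂P = 1 - p := fun r => by
    have h1 : X r = Set.indicator {ω | S r ω = true} 1 := by
      ext ω
      simp [X, φ, Set.indicator_apply]
    rw [h1, integral_indicator_one (hS.measurableSet_eq r true), hS.prob_success]
  have hvar1 : ∀ r, variance (X r) P ≤ 1 := fun r => by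
    refine (variance_le_expectation_sq (hXm r).aestronglyMeasurable).trans ?_
    have h1 : ∫ _ω, (1 : ℝ) ∂P = 1 := by simp
    rw [← h1]
    refine integral_mono (hX2 r).integrable_sq (integrable_const _) fun ω => ?_
    have := hX01 r ω
    simp only [Pi.pow_apply]
    nlinarith [this.1, this.2]
  let Y : Ω → ℝ := ∑ r ∈ Finset.range T, X r
  have hY2 : MemLp Y 2 P := memLp_finsetSum' _ fun r _ => hX2 r
  have hYmean : ∫ ω, Y ω ∂P = T * (1 - p) := by
    simp only [Y, Finset.sum_apply]
    rw [integral_finsetSum _ fun r _ => (hX2 r).integrable (by norm_num)]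
    simp only [hmean, Finset.sum_const, Finset.card_range, nsmul_eq_mul]
  have hYvar : variance Y P ≤ T := by
    rw [IndepFun.variance_sum (fun r _ => hX2 r) fun i _ j _ hij =>
      (hS.indep.indepFun hij).comp hφ hφ]
    refine (Finset.sum_le_sum fun r _ => hvar1 r).trans ?_
    simp
  have hYcount : ∀ ω, Y ω = Nat.count (fun r => S r ω = true) T := fun ω => by
    simp [Y, X, φ, Nat.count_eq_card_filter_range]
  have hcheb := meas_ge_le_variance_div_sq hY2 (by positivity : 0 < T * c)
  rw [hYmean] at hcheb
  have hcheb' : P.real {ω | T * c ≤ |Y ω - T * (1 - p)|} ≤ variance Y P / (T * c) ^ 2 :=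
    ENNReal.toReal_le_of_le_ofReal (div_nonneg (variance_nonneg _ _) (sq_nonneg _)) hcheb
  calc P.real {ω | (Nat.count (fun r => S r ω = true) T : ℝ) < T * (1 - p) - T * c}
      ≤ P.real {ω | T * c ≤ |Y ω - T * (1 - p)|} := by
        refine measureReal_mono fun ω hω => ?_
        simp only [Set.mem_ofPred_eq, hYcount] at hω ⊢
        rw [abs_of_nonpos (by nlinarith)]
        linarith
    _ ≤ variance Y P / (T * c) ^ 2 := hcheb'
    _ ≤ T / (T * c) ^ 2 := by gcongr
    _ = 1 / (T * c ^ 2) := by field_simp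

/-- With high probability there are infinitely many successes, no long run of failures starts in the
first `T` rounds, and the successes in these rounds are about as many as expected. -/
lemma IsBinaryRecovery.prob_typical_ge (hS : IsBinaryRecovery P S p) (hp0 : 0 < p) (hp : p < 1)
    {T : ℕ} (hT : 0 < T) (M : ℕ) {c : ℝ} (hc : 0 < c) :
    1 - (T * p ^ M + 1 / (T * c ^ 2)) ≤ P.real {ω | {r | S r ω = true}.Infinite ∧
      (∀ r < T, ∃ i < M, S (r + i) ω = true) ∧
      T * (1 - p) - T * c ≤ (Nat.count (fun r => S r ω = true) T : ℝ)} := by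
  set A := {ω | {r | S r ω = true}.Infinite ∧ (∀ r < T, ∃ i < M, S (r + i) ω = true) ∧
      T * (1 - p) - T * c ≤ (Nat.count (fun r => S r ω = true) T : ℝ)} with hA
  set B := {ω | ∃ r < T, ∀ i < M, S (r + i) ω = false}
  set C := {ω | (Nat.count (fun r => S r ω = true) T : ℝ) < T * (1 - p) - T * c}
  set N := {ω | ¬{r | S r ω = true}.Infinite}
  have hN : P.real N = 0 := by
    rw [measureReal_eq_zero_iff]
    exact ae_iff.1 (hS.ae_infinite hp0.le hp)
  have hcover : (Set.univ : Set Ω) ⊆ A ∪ (B ∪ C ∪ N) := fun ω _ => by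
    by_cases hωN : ω ∈ N
    · exact .inr (.inr hωN)
    by_cases hωB : ω ∈ B
    · exact .inr (.inl (.inl hωB))
    by_cases hωC : ω ∈ C
    · exact .inr (.inl (.inr hωC))
    refine .inl ⟨not_not.1 hωN, fun r hr => ?_, not_lt.1 hωC⟩
    by_contra hne
    refine hωB ⟨r, hr, fun i hi => ?_⟩
    push Not at hne
    simpa using hne i hi
  have h1 : (1 : ℝ) ≤ P.real A + P.real (B ∪ C ∪ N) := by
    calc (1 : ℝ) = P.real Set.univ := by simp
      _ ≤ P.real (A ∪ (B ∪ C ∪ N)) := measureReal_mono hcover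
      _ ≤ _ := measureReal_union_le _ _
  have h2 : P.real (B ∪ C ∪ N) ≤ P.real B + P.real C + P.real N :=
    (measureReal_union_le _ _).trans (by gcongr; exact measureReal_union_le _ _)
  have h3 := hS.prob_exists_run_le T M
  have h4 := hS.prob_count_lt_le hT hc
  linarith

end Recovery

/-! ### Choice of the constants -/

lemma exists_forall_pow_four_le_mul_two_pow {ε : ℝ} (hε : 0 < ε) :
    ∃ l₀ : ℕ, ∀ l ≥ l₀, ((l : ℝ) + 1) ^ 4 ≤ ε * 2 ^ l := by
  have h := (tendsto_pow_const_div_const_pow_of_one_lt 4 (one_lt_two (α := ℝ))).comp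
    (Filter.tendsto_add_atTop_nat 1)
  obtain ⟨l₀, hl₀⟩ := Filter.eventually_atTop.1 (h.eventually_le_const (half_pos hε))
  refine ⟨l₀, fun l hl => ?_⟩
  have h1 := hl₀ l hl
  simp only [Function.comp_apply, Nat.cast_add, Nat.cast_one] at h1
  rw [div_le_iff₀ (by positivity), pow_succ (2 : ℝ)] at h1
  linarith

/-- The tolerances of the typical event are of the form `c (log T) ^ 4 / T`, so they are met for all
large `T`. Runs of length `M ≥ 2 log₂ T` are unlikely since `p < 1 / 3` makes `T p ^ M ≤ 1 / T`. -/
lemma exists_run_length {p : ℝ} (hp0 : 0 < p) (hp : p < 1 / 3) {c δ C : ℝ} (hc : 0 < c)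
    (hδ : 0 < δ) (hC : 0 < C) :
    ∃ T₀ : ℕ, ∀ T : ℕ, T₀ ≤ T → 0 < T ∧ ∃ M : ℕ,
      √(C / T) * M ^ 2 ≤ δ ∧ (M : ℝ) ≤ T * (p / 4) ∧
        T * p ^ M + 1 / (T * c ^ 2) < 1 - 0.9973 := by
  set ε : ℝ := min (min (δ ^ 2 / (16 * C)) (p / 8)) (0.001 / (1 + 1 / c ^ 2)) with hεdef
  have hε : 0 < ε := by positivity
  have hε1 : ε ≤ δ ^ 2 / (16 * C) := (min_le_left _ _).trans (min_le_left _ _)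
  have hε2 : ε ≤ p / 8 := (min_le_left _ _).trans (min_le_right _ _)
  have hε3 : ε ≤ 0.001 / (1 + 1 / c ^ 2) := min_le_right _ _
  obtain ⟨l₀, hl₀⟩ := exists_forall_pow_four_le_mul_two_pow hε
  refine ⟨2 ^ l₀, fun T hT => ?_⟩
  have hT0 : 0 < T := lt_of_lt_of_le (by positivity) hT
  refine ⟨hT0, 2 * (Nat.log 2 T + 1), ?_⟩
  set l := Nat.log 2 T with hl
  have hl1 : l₀ ≤ l := (Nat.le_log_iff_pow_le one_lt_two hT0.ne').2 hT
  have hlT : (2 : ℝ) ^ l ≤ T := by exact_mod_cast Nat.pow_log_le_self 2 hT0.ne'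
  have hTl : (T : ℝ) < 2 ^ (l + 1) := by exact_mod_cast Nat.lt_pow_succ_log_self one_lt_two T
  have hT' : (0 : ℝ) < T := by exact_mod_cast hT0
  have h4 : ((l : ℝ) + 1) ^ 4 ≤ ε * T := (hl₀ l hl1).trans (by gcongr)
  have hl0 : (1 : ℝ) ≤ (l : ℝ) + 1 := by linarith [(Nat.cast_nonneg l : (0 : ℝ) ≤ l)]
  push_cast
  refine ⟨?_, ?_, ?_⟩
  · have h5 : ((2 * ((l : ℝ) + 1)) ^ 2) ^ 2 * (C / T) ≤ δ ^ 2 := by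
      calc ((2 * ((l : ℝ) + 1)) ^ 2) ^ 2 * (C / T) = 16 * C * ((l : ℝ) + 1) ^ 4 / T := by ring
        _ ≤ 16 * C * (δ ^ 2 / (16 * C) * T) / T := by gcongr; exact h4.trans (by gcongr)
        _ = δ ^ 2 := by field_simp
    have h6 : 0 ≤ (2 * ((l : ℝ) + 1)) ^ 2 := by positivity
    rw [mul_comm]
    refine abs_le_of_sq_le_sq' ?_ hδ.le |>.2
    rw [mul_pow, Real.sq_sqrt (by positivity)]
    exact h5
  · have h5 : (l : ℝ) + 1 ≤ ((l : ℝ) + 1) ^ 4 := le_self_pow₀ hl0 (by norm_num)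
    have h6 : ε * T ≤ p / 8 * T := by gcongr
    linarith
  · have h5 : 1 ≤ ε * T := (one_le_pow₀ hl0).trans h4
    have h6 : (T : ℝ) * p ^ (2 * (l + 1)) ≤ 1 / T := by
      have h7 : p ^ (2 * (l + 1)) ≤ (1 / 4) ^ (l + 1) := by
        rw [pow_mul]
        gcongr
        nlinarith
      have h8 : (1 / 4 : ℝ) ^ (l + 1) ≤ 1 / T ^ 2 := by
        rw [div_pow, one_pow]
        gcongr
        calc (T : ℝ) ^ 2 ≤ (2 ^ (l + 1)) ^ 2 := by gcongr
          _ = 4 ^ (l + 1) := by rw [← pow_mul, mul_comm, pow_mul]; norm_num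
      calc (T : ℝ) * p ^ (2 * (l + 1)) ≤ T * (1 / T ^ 2) := by gcongr; exact h7.trans h8
        _ = 1 / T := by field_simp
    have h7 : 1 / (T : ℝ) ≤ ε := by rwa [div_le_iff₀ hT']
    have h8 : 0 < 1 + 1 / c ^ 2 := by positivity
    calc T * p ^ (2 * (l + 1)) + 1 / (T * c ^ 2) ≤ 1 / T + 1 / (T * c ^ 2) := by gcongr
      _ = 1 / T * (1 + 1 / c ^ 2) := by field_simp
      _ ≤ 0.001 / (1 + 1 / c ^ 2) * (1 + 1 / c ^ 2) := 
        mul_le_mul_of_nonneg_right (h7.trans hε3) h8.le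
      _ = 0.001 := by field_simp
      _ < 1 - 0.9973 := by norm_num

/-- Passage from the sum over the updates to the mean. The four factors `1 ± p / 4` fit between
`(1 + p)` and `(1 - p)`, which is the room left by the second moment of the period lengths. -/
lemma mean_le_of_sum_le {p n T u c B δ Sn W : ℝ} (hp0 : 0 < p) (hp : p < 1 / 3) (hT : 0 < T)
    (hu : 0 ≤ u) (hc : 0 ≤ c) (hB : 0 ≤ B) (hδ0 : 0 ≤ δ) (hδ : 2 * δ ≤ p / 4)
    (hSn : Sn ≤ T * (1 + p / 4)) (hn : T * (1 - p) * (1 - p / 4) ≤ n)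
    (hsum : (1 - p / 4) * W ≤ c + 2 * u * (1 + 2 * δ) * B * Sn) :
    1 / n * W ≤ c / (T * (1 - p) * (1 - 3 * p)) + 2 * u * B * ((1 + p) / (1 - p) ^ 2) := by
  have hq : 0 < 1 - p / 4 := by linarith
  have h1p : 0 < 1 - p := by linarith
  have h3p : 0 < 1 - 3 * p := by linarith
  have hn0 : 0 < n := lt_of_lt_of_le (by positivity) hn
  have h1 : (1 - p / 4) * W ≤ c + 2 * u * B * ((1 + p / 4) ^ 2 * T) := by
    refine hsum.trans ?_
    have : 2 * u * (1 + 2 * δ) * B * Sn ≤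
        2 * u * (1 + p / 4) * B * (T * (1 + p / 4)) :=
      (mul_le_mul_of_nonneg_left hSn (by positivity)).trans (by gcongr)
    linarith
  have h2 : W ≤ (c + 2 * u * B * ((1 + p / 4) ^ 2 * T)) / (1 - p / 4) := by
    rw [le_div_iff₀ hq]
    linarith
  have h3 : 1 - 3 * p ≤ (1 - p / 4) ^ 2 := by nlinarith
  have h4 : (1 + p / 4) ^ 2 / ((1 - p) * (1 - p / 4) ^ 2) ≤ (1 + p) / (1 - p) ^ 2 := by
    rw [div_le_div_iff₀ (by positivity) (by positivity)]
    have h5 : (1 + p / 4) ^ 2 * (1 - p) ≤ (1 + p) * (1 - p / 4) ^ 2 := by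
      nlinarith [pow_pos hp0 3]
    nlinarith [mul_le_mul_of_nonneg_right h5 h1p.le]
  calc 1 / n * W ≤ 1 / n * ((c + 2 * u * B * ((1 + p / 4) ^ 2 * T)) / (1 - p / 4)) := by gcongr
    _ ≤ 1 / (T * (1 - p) * (1 - p / 4)) *
        ((c + 2 * u * B * ((1 + p / 4) ^ 2 * T)) / (1 - p / 4)) := by gcongr
    _ = c / (T * (1 - p) * (1 - p / 4) ^ 2) +
        2 * u * B * ((1 + p / 4) ^ 2 / ((1 - p) * (1 - p / 4) ^ 2)) := by
      field_simp
    _ ≤ c / (T * (1 - p) * (1 - 3 * p)) + 2 * u * B * ((1 + p) / (1 - p) ^ 2) := by gcongr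

/-! ### The convergence bound -/

theorem mainTheorem1
    (K I : ℕ) (hK : 0 < K)
    (a : Fin I → ℝ) (ha : ∀ i, 0 ≤ a i) (ha0 : a ≠ 0)
    (PO : ℝ) (hPO0 : 0 < PO) (hPO1 : PO < 1 / 3)
    (β : ℝ) (hβ : 1 ≤ β ^ 2) :
    (∃ T₀ : ℕ, ∀ T : ℕ, T₀ ≤ T →
      ∀ (D : ℕ) (L : Fin K → EuclideanSpace ℝ (Fin D) → ℝ)
        (G Lstar σ κ : ℝ) (Θ₀ : EuclideanSpace ℝ (Fin D))
        (Ξ : Type*) [MeasurableSpace Ξ] (ν : Fin K → Measure Ξ)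
        (g : Fin K → EuclideanSpace ℝ (Fin D) → Ξ → EuclideanSpace ℝ (Fin D))
        -- the probability space of the mini-batches
        (Ω : Type*) [MeasurableSpace Ω] (Q : Measure Ω) [IsProbabilityMeasure Q]
        (ξ : ℕ → Fin I → Fin K → Ω → Ξ)
        -- the probability space of the recovery outcomes
        (Ω' : Type*) [MeasurableSpace Ω'] (P : Measure Ω') [IsProbabilityMeasure P]
        (S : ℕ → Ω' → Bool),
        0 < G → 0 < σ ^ 2 →
        Smoothness L G Lstar →
        UnbiasedBoundedVariance L g ν σ →
        BoundedDissimilarity L β κ →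
        IsMiniBatchSampling Q ν ξ →
        IsBinaryRecovery P S PO →
        ∀ η : ℝ, η = 1 / G * √((K : ℝ) / T) →
        0.9973 < P.real {ω' |
          let s : ℕ → Bool := fun r => S r ω'
          let Tc : ℕ := numUpdates s T
          -- the squared gradient norm at the global model after `t` successful recoveries
          let N : ℕ → Ω → ℝ :=
            fun t ω => sqGradNorm L η a g Θ₀ s (fun r i k => ξ r i k ω) t
          (∀ t ∈ Finset.Icc 1 Tc, Integrable (N (t - 1)) Q) ∧
          (1 / (Tc : ℝ)) * ∑ t ∈ Finset.Icc 1 Tc, ∫ ω, N (t - 1) ω ∂Q ≤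
            (1 / (Tc : ℝ)) * ∑ t ∈ Finset.Icc 1 Tc,
              (roundsBetween s t : ℝ) * ∫ ω, N (t - 1) ω ∂Q ∧
          (1 / (Tc : ℝ)) * ∑ t ∈ Finset.Icc 1 Tc,
              (roundsBetween s t : ℝ) * ∫ ω, N (t - 1) ω ∂Q ≤
            2 * G * (globalLoss L Θ₀ - Lstar) /
                (l1Norm a * (1 - PO) * (1 - 3 * PO) * √((K : ℝ) * T)) +
              2 * √((K : ℝ) / T) * l1Norm a * ((1 - PO) / PO) * psi T PO *
                (σ ^ 2 + 2 * κ ^ 2)}) ∧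
    (∀ (v : ℕ) (z : ℝ), |z| < 1 →
      HasSum (fun k : ℕ => ((k : ℝ) + 1) ^ v * z ^ (k + 1))
        (((fun (f : ℝ → ℝ) (x : ℝ) => x * deriv f x)^[v] (fun x => x / (1 - x))) z)) := by
  refine ⟨?_, hasSum_iterate_euler⟩
  have hI : 0 < I := by
    rcases Nat.eq_zero_or_pos I with rfl | h
    · exact absurd (Subsingleton.elim a 0) ha0
    · exact h
  have hA : 0 < l1Norm a := by
    obtain ⟨i, hi⟩ := Function.ne_iff.1 ha0
    exact Finset.sum_pos' (fun i _ => abs_nonneg _) ⟨i, Finset.mem_univ i, abs_pos.2 hi⟩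
  have hβ0 : 0 < β ^ 2 := by linarith
  have hK' : (0 : ℝ) < K := by exact_mod_cast hK
  -- `8 δ β ^ 2`, the part of the squared gradients lost to the drift, becomes `PO / 4`
  set δ : ℝ := PO / (32 * β ^ 2) with hδdef
  have hδ0 : 0 < δ := by positivity
  have hδβ : 8 * δ * β ^ 2 = PO / 4 := by
    have hβne : β ≠ 0 := fun h => by simp [h] at hβ0
    rw [hδdef]
    field_simp
    norm_num
  have hδ1 : 2 * δ ≤ PO / 4 := by nlinarith
  have h1P : 0 < 1 - PO := by linarith
  have h3P : 0 < 1 - 3 * PO := by linarith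
  obtain ⟨T₀, hT₀⟩ := exists_run_length hPO0 hPO1 (c := (1 - PO) * (PO / 4))
    (δ := δ / l1Norm a) (C := K) (by positivity) (by positivity) hK'
  refine ⟨T₀, fun T hT D L G Lstar σ κ Θ₀ Ξ _ ν g Ω _ Q _ ξ Ω' _ P _ S hG _ hL hg hd hξ hS η hη =>
    ?_⟩
  obtain ⟨hTpos, M, hM, hMT, hprob⟩ := hT₀ T hT
  have hT' : (0 : ℝ) < T := by exact_mod_cast hTpos
  have htyp := hS.prob_typical_ge hPO0 (by linarith) hTpos M
    (c := (1 - PO) * (PO / 4)) (by positivity)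
  refine (lt_sub_comm.1 hprob).trans_le (htyp.trans (measureReal_mono ?_))
  rintro ω' ⟨hs, hrun, hcount⟩
  simp only [Set.mem_ofPred_eq]
  let s : ℕ → Bool := fun r => S r ω'
  change {r | s r = true}.Infinite at hs
  change ∀ r < T, ∃ i < M, s (r + i) = true at hrun
  set n := numUpdates s T with hn
  have hη0 : 0 < η := by
    rw [hη]
    positivity
  have hu : G * η * l1Norm a = √((K : ℝ) / T) * l1Norm a := by
    rw [hη]
    field_simp
  have hN : ∀ t, 0 ≤ ∫ ω, sqGradNorm L η a g Θ₀ s (fun r i k => ξ r i k ω) t ∂Q := fun t =>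
    integral_nonneg fun ω => sq_nonneg _
  have hRM : ∀ t < n, roundsBetween s (t + 1) ≤ M := fun t ht =>
    roundsBetween_le_of_no_run hs hrun ht
  refine ⟨fun t _ => integrable_sqGradNorm hI hK hL hg hξ Θ₀ hs _, ?_, ?_⟩
  · rw [sum_Icc_one_eq_sum_range, sum_Icc_one_eq_sum_range]
    gcongr with t
    have h1 : (1 : ℝ) ≤ roundsBetween s (t + 1) := by exact_mod_cast one_le_roundsBetween hs t
    exact le_mul_of_one_le_left (hN _) h1
  · rw [sum_Icc_one_eq_sum_range]
    simp only [Nat.add_sub_cancel]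
    have hsum := sum_rounds_mul_integral_sqGradNorm_le (β := β) (κ := κ) hI hK hG hη0 ha hA hL hg hd
      hξ Θ₀ hs (M := M) (δ := δ) (by linarith)
      (by
        rw [hu]
        calc √((K : ℝ) / T) * l1Norm a * M ^ 2 = √((K : ℝ) / T) * M ^ 2 * l1Norm a := by ring
          _ ≤ δ / l1Norm a * l1Norm a := by gcongr
          _ = δ := by field_simp)
      n (fun t ht => by exact_mod_cast hRM t ht)
    rw [hδβ] at hsum
    -- the last period may end after round `T`, but it has at most `M` rounds
    have hSn : (successTime s n : ℝ) ≤ T * (1 + PO / 4) := by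
      have h1 : successTime s n ≤ T + M := by
        rcases Nat.eq_zero_or_pos n with h0 | h0
        · rw [h0]
          exact Nat.zero_le _
        · have h2 := roundsBetween_succ_add hs (n - 1)
          have h3 := hRM (n - 1) (by omega)
          have h4 := successTime_lt_of_lt_numUpdates hs (T := T) (t := n - 1) (by omega)
          rw [Nat.sub_add_cancel h0] at h2 h3
          omega
      have h2 : (successTime s n : ℝ) ≤ T + M := by exact_mod_cast h1
      linarith
    have hcn : (T : ℝ) * (1 - PO) * (1 - PO / 4) ≤ n := by
      have h1 : (Nat.count (fun r => s r = true) T : ℝ) ≤ n := by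
        exact_mod_cast count_le_numUpdates hs T
      linarith
    have hΔ : 0 ≤ globalLoss L Θ₀ - Lstar := sub_nonneg.2 (hL.le_globalLoss hK Θ₀)
    have hmean := mean_le_of_sum_le hPO0 hPO1 hT' (by positivity : 0 ≤ G * η * l1Norm a)
      (by positivity : 0 ≤ 2 / (η * l1Norm a) * (globalLoss L Θ₀ - Lstar))
      (by positivity : 0 ≤ σ ^ 2 + 2 * κ ^ 2) hδ0.le hδ1 hSn hcn hsum
    have hfirst : 2 / (η * l1Norm a) * (globalLoss L Θ₀ - Lstar) /
        (T * (1 - PO) * (1 - 3 * PO)) = 2 * G * (globalLoss L Θ₀ - Lstar) /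
          (l1Norm a * (1 - PO) * (1 - 3 * PO) * √((K : ℝ) * T)) := by
      have h1 : √((K : ℝ) * T) = G * η * T := by
        have h2 : (K : ℝ) * T = K / T * T ^ 2 := by field_simp
        rw [h2, Real.sqrt_mul (by positivity), Real.sqrt_sq hT'.le, hη]
        field_simp
      rw [h1]
      field_simp
    rw [hfirst, hu] at hmean
    refine hmean.trans (add_le_add le_rfl ?_)
    calc 2 * (√((K : ℝ) / T) * l1Norm a) * (σ ^ 2 + 2 * κ ^ 2) * ((1 + PO) / (1 - PO) ^ 2)
        ≤ 2 * (√((K : ℝ) / T) * l1Norm a) * (σ ^ 2 + 2 * κ ^ 2) *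
          ((1 - PO) / PO * psi T PO) := by
          gcongr
          exact le_psi hPO0 hPO1
      _ = _ := by ring
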